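/- Let $b_1,b_2>0$ and $0<x_2<1$. Let $a$ be the $1$-periodic function with $a=b_2^{-2}$ on $[0,x_2)$ and $a=b_1^{-2}$ on $[x_2,1)$. For $k\ge 1$ let $a_k=a$ on $[0,k]$ and $a_k=b_1^{-2}$ outside $[0,k]$, and let $P_k=-\partial_x a_k\partial_x$ on $L^2(\mathbb R)$ with domain $\{u\in H^1(\mathbb R): a_k\partial_x u\in H^1(\mathbb R)\}$. For $\operatorname{Im}\lambda>0$ let $R_k(\lambda)=(P_k-\lambda^2)^{-1}$. As a function with values in the operators $L^2_{\rm comp}(\mathbb R)\to L^2_{\rm loc}(\mathbb R)$ (that is, after multiplication on both sides by the indicator function of any interval $[-N,N]$, in operator norm), $R_k$ has a meromorphic continuation to $\lambda\in\mathbb C$; let $\mathrm{Res}(P_k)$ be the set of its poles in $\mathbb C_-=\{\operatorname{Im}\lambda<0\}$. With $\rho=\frac{b_1^2+b_2^2}{2b_1b_2}$ put, for $\lambda\in\mathbb R$, $$F(\lambda)=\tfrac{\rho+1}{2}\cos\{\lambda(x_2b_2+(1-x_2)b_1)\}-\tfrac{\rho-1}{2}\cos\{\lambda(x_2b_2-(1-x_2)b_1)\}.$$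 The bands of the periodic operator $P=-\partial_x a\partial_x$ are the connected components of $\{\lambda\in\mathbb R:|F(\lambda)|^2<1\}$, and a degenerate band edge is a solution of $F=\pm1$ that is a boundary point of two different bands. Then the following hold. (2) If $b_2x_2=b_1(1-x_2)$, then for every $m\in\mathbb Z$ the point $\lambda_0=\pi m/(x_2b_2)$ is a degenerate band edge, and for every $k\ge1$ the set $\mathrm{Res}(P_k)$ is invariant under translation by the real number $T=\pi/(b_2x_2)$: $\lambda\in\mathrm{Res}(P_k)$ if and only if $\lambda+T\in\mathrm{Res}(P_k)$. (3) As $k\to\infty$ the set $\mathrm{Res}(P_k)$ approaches the real axis: for every $\varepsilon>0$ there is $K$ such that $|\operatorname{Im}\lambda|<\varepsilon$ for all $k\ge K$ and all $\lambda\in\mathrm{Res}(P_k)$. -/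

import Mathlib

open MeasureTheory Set Filter Topology
open scoped ContDiff

noncomputable section

namespace LayeredResonances

/-- The complex Hilbert space `L²(ℝ)`. -/
abbrev L2R : Type := Lp ℂ 2 (volume : Measure ℝ)

/-- The two-layer unit cell: `b₂⁻²` on `[0, x₂)` and `b₁⁻²` on `[x₂, 1)`. -/
def cellCoeff (b₁ b₂ x₂ : ℝ) (x : ℝ) : ℝ :=
  if x < x₂ then (b₂ ^ 2)⁻¹ else (b₁ ^ 2)⁻¹

/-- The `1`-periodic extension `a` of the unit cell. -/
def periodicCoeff (b₁ b₂ x₂ : ℝ) (x : ℝ) : ℝ :=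
  cellCoeff b₁ b₂ x₂ (Int.fract x)

open Classical in
/-- The locally periodic coefficient `a_k`: equal to `a` on `[0, k]` (that is, `k` identical cells)
and to `b₁⁻²` outside. -/
def truncatedCoeff (b₁ b₂ x₂ : ℝ) (k : ℕ) (x : ℝ) : ℝ :=
  if x ∈ Icc (0 : ℝ) k then periodicCoeff b₁ b₂ x₂ x else (b₁ ^ 2)⁻¹

/-- `w ∈ L²(ℝ)` is the weak derivative of `u ∈ L²(ℝ)`; in particular `u ∈ H¹(ℝ)`. -/
def HasWeakDeriv (u w : L2R) : Prop :=
  ∀ φ : ℝ → ℂ, ContDiff ℝ ∞ φ → HasCompactSupport φ →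
    ∫ x, u x * deriv φ x = - ∫ x, w x * φ x

/-- The graph of the operator `P = -∂ₓ a ∂ₓ` on `L²(ℝ)` with domain
`{u ∈ H¹(ℝ) : a ∂ₓ u ∈ H¹(ℝ)}`: `u` lies in the domain and `P u = f`. -/
def OperatorGraph (a : ℝ → ℝ) (u f : L2R) : Prop :=
  ∃ w q : L2R, HasWeakDeriv u w ∧ (∀ᵐ x : ℝ, q x = (a x : ℂ) * w x) ∧ HasWeakDeriv q (-f)

/-- `R = (P - lam²)⁻¹`, a bounded operator defined on all of `L²(ℝ)`: `u` lies in the domain of `P`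
and `(P - lam²) u = v` if and only if `u = R v`. -/
def IsResolventAt (a : ℝ → ℝ) (lam : ℂ) (R : L2R →L[ℂ] L2R) : Prop :=
  ∀ u v : L2R, OperatorGraph a u (lam ^ 2 • u + v) ↔ u = R v

/-- The product `1_{[-N, N]} f` for `f ∈ L²(ℝ)`. -/
def cutoffFun (N : ℕ) (f : L2R) : L2R :=
  MemLp.toLp ((Icc (-(N : ℝ)) (N : ℝ)).indicator f) ((Lp.memLp f).indicator measurableSet_Icc)

theorem cutoffFun_ae (N : ℕ) (f : L2R) :
    ∀ᵐ x : ℝ, cutoffFun N f x = (Icc (-(N : ℝ)) (N : ℝ)).indicator f x :=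
  MemLp.coeFn_toLp _

theorem cutoffFun_add (N : ℕ) (f g : L2R) :
    cutoffFun N (f + g) = cutoffFun N f + cutoffFun N g := by
  refine Lp.ext ?_
  filter_upwards [cutoffFun_ae N (f + g), cutoffFun_ae N f, cutoffFun_ae N g, Lp.coeFn_add f g,
    Lp.coeFn_add (cutoffFun N f) (cutoffFun N g)] with x h1 h2 h3 h4 h5
  rw [h1, h5, Pi.add_apply, h2, h3]
  by_cases hx : x ∈ Icc (-(N : ℝ)) (N : ℝ)
  · simp only [indicator_of_mem hx, h4, Pi.add_apply]
  · simp only [indicator_of_notMem hx, add_zero]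

theorem cutoffFun_smul (N : ℕ) (c : ℂ) (f : L2R) :
    cutoffFun N (c • f) = c • cutoffFun N f := by
  refine Lp.ext ?_
  filter_upwards [cutoffFun_ae N (c • f), cutoffFun_ae N f, Lp.coeFn_smul c f,
    Lp.coeFn_smul c (cutoffFun N f)] with x h1 h2 h3 h4
  rw [h1, h4, Pi.smul_apply, h2]
  by_cases hx : x ∈ Icc (-(N : ℝ)) (N : ℝ)
  · simp only [indicator_of_mem hx, h3, Pi.smul_apply]
  · simp only [indicator_of_notMem hx, smul_zero]

theorem norm_cutoffFun_le (N : ℕ) (f : L2R) : ‖cutoffFun N f‖ ≤ 1 * ‖f‖ := by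
  rw [one_mul]
  refine Lp.norm_le_norm_of_ae_le ?_
  filter_upwards [cutoffFun_ae N f] with x h1
  rw [h1]
  exact norm_indicator_le_norm_self _ _

/-- Multiplication by the indicator function of `[-N, N]`, as a bounded operator on `L²(ℝ)`. -/
def cutoff (N : ℕ) : L2R →L[ℂ] L2R :=
  LinearMap.mkContinuous
    { toFun := cutoffFun N
      map_add' := cutoffFun_add N
      map_smul' := cutoffFun_smul N }
    1 (norm_cutoffFun_le N)

/-- `T` is the meromorphic continuation to `ℂ` of the operator-valued function
`lam ↦ 1_{[-N,N]} (P - lam²)⁻¹ 1_{[-N,N]}`, given for `Im lam > 0`. A meromorphic continuation of the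
resolvent as a map `L²_comp(ℝ) → L²_loc(ℝ)` is a compatible family of these for `N = 1, 2, …`. -/
def IsContinuedResolvent (a : ℝ → ℝ) (N : ℕ) (T : ℂ → (L2R →L[ℂ] L2R)) : Prop :=
  Meromorphic T ∧
    ∀ lam : ℂ, 0 < lam.im → ∃ R : L2R →L[ℂ] L2R,
      IsResolventAt a lam R ∧ T lam = cutoff N ∘L R ∘L cutoff N

/-- The resonances of `-∂ₓ a ∂ₓ`: the poles in the open lower half plane of the meromorphic
continuation of the resolvent `L²_comp(ℝ) → L²_loc(ℝ)`. -/
def Res (a : ℝ → ℝ) : Set ℂ :=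
  {lam | lam.im < 0 ∧ ∃ (N : ℕ) (T : ℂ → (L2R →L[ℂ] L2R)),
    IsContinuedResolvent a N T ∧ meromorphicOrderAt T lam < 0}

/-- The number `ρ = (b₁² + b₂²) / (2 b₁ b₂)`. -/
def rho (b₁ b₂ : ℝ) : ℝ := (b₁ ^ 2 + b₂ ^ 2) / (2 * b₁ * b₂)

/-- The Lyapunov function of the periodic operator `-∂ₓ a ∂ₓ` on the real frequency axis. -/
def lyapunov (b₁ b₂ x₂ : ℝ) (lam : ℝ) : ℝ :=
  (rho b₁ b₂ + 1) / 2 * Real.cos (lam * (x₂ * b₂ + (1 - x₂) * b₁))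
    - (rho b₁ b₂ - 1) / 2 * Real.cos (lam * (x₂ * b₂ - (1 - x₂) * b₁))

/-- The allowed zones on the frequency axis. -/
def bandSpectrum (b₁ b₂ x₂ : ℝ) : Set ℝ :=
  {lam | |lyapunov b₁ b₂ x₂ lam| ^ 2 < 1}

/-- A band (allowed zone) is a connected component of `bandSpectrum`. -/
def IsBand (b₁ b₂ x₂ : ℝ) (J : Set ℝ) : Prop :=
  ∃ lam ∈ bandSpectrum b₁ b₂ x₂, J = connectedComponentIn (bandSpectrum b₁ b₂ x₂) lam

/-- A degenerate band edge: a solution of `F = ±1` that is a boundary point of two different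
bands. -/
def IsDegenerateBandEdge (b₁ b₂ x₂ : ℝ) (lam₀ : ℝ) : Prop :=
  (lyapunov b₁ b₂ x₂ lam₀ = 1 ∨ lyapunov b₁ b₂ x₂ lam₀ = -1) ∧
    ∃ J₁ J₂ : Set ℝ, IsBand b₁ b₂ x₂ J₁ ∧ IsBand b₁ b₂ x₂ J₂ ∧ J₁ ≠ J₂ ∧
      lam₀ ∈ frontier J₁ ∧ lam₀ ∈ frontier J₂

end LayeredResonances

end

/-!
In terms of `u` and the flux `q = a u'`, the equation `-(a u')' = λ² u` is a first-order system with
continuous solutions, explicit and entire in `λ` when the coefficient is piecewise constant. The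
Green kernel built from the solution outgoing to the left and the one outgoing to the right, divided
by their Wronskian `D(λ)`, gives the resolvent for `Im λ > 0`. Multiplied by `D` the cut-off kernel
is entire and is never the zero operator on a large interval, so the resonances are exactly the
zeros of `D` in the lower half plane.

A layer of slowness `b` and width `ℓ` enters `D` only through the phase `λ b ℓ`. In a balanced cell
both phases grow by `π` under `λ ↦ λ + T`, which changes the transfer matrices by a sign only and so
preserves the zeros of `D`.

Below the real axis, crossing a cell multiplies the energy flux of a wave by at least
`exp (2 |Im λ| L)`, with `L` the optical length of the cell. The cell matrix has determinant one, so
one of its eigenvalues `μ` satisfies `|μ| ≥ q > 1`, uniformly on `Im λ ≤ -ε`. A zero of `D` for `k`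
cells annihilates an entry of the `k`-th power of the cell matrix, which bounds `|μ| ^ k`
and is impossible once `k` is large.
-/

noncomputable section

namespace LayeredResonances

open Complex (I)
open scoped NNReal ENNReal

/-! ### Integral operators on `L²` -/

section SchurTest

variable {α β 𝕜 : Type*} [MeasurableSpace α] [MeasurableSpace β] [RCLike 𝕜]
  {μ : Measure α} {ν : Measure β}

/-- The hypothesis of Schur's test: a measurable kernel whose rows and columns have `L¹` norm at
most `A`. -/
structure IsSchurKernel (μ : Measure α) (ν : Measure β) (K : α → β → 𝕜) (A : ℝ≥0) : Prop where
  measurable : Measurable (Function.uncurry K)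
  lintegral_right_le : ∀ x, ∫⁻ y, ‖K x y‖ₑ ∂ν ≤ A
  lintegral_left_le : ∀ y, ∫⁻ x, ‖K x y‖ₑ ∂μ ≤ A

/-- `L` is the integral operator with kernel `K`. -/
def HasKernel (L : Lp 𝕜 2 ν →L[𝕜] Lp 𝕜 2 μ) (K : α → β → 𝕜) : Prop :=
  ∀ f, ∀ᵐ x ∂μ, L f x = ∫ y, K x y * f y ∂ν

theorem HasKernel.unique {K : α → β → 𝕜} {L L' : Lp 𝕜 2 ν →L[𝕜] Lp 𝕜 2 μ} (h : HasKernel L K)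
    (h' : HasKernel L' K) : L = L' := by
  ext1 f
  refine Lp.ext ?_
  filter_upwards [h f, h' f] with x h1 h2
  rw [h1, h2]

theorem HasKernel.const_smul {K : α → β → 𝕜} {L : Lp 𝕜 2 ν →L[𝕜] Lp 𝕜 2 μ} (h : HasKernel L K)
    (c : 𝕜) : HasKernel (c • L) fun x y ↦ c * K x y := by
  intro f
  filter_upwards [h f, Lp.coeFn_smul c (L f)] with x h1 h2
  rw [_root_.smul_apply, h2, Pi.smul_apply, h1, smul_eq_mul, ← integral_const_mul]
  simp only [mul_assoc]

theorem sq_lintegral_mul_le (μ : Measure α) {k g : α → ℝ≥0∞} (hk : Measurable k)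
    (hg : Measurable g) :
    (∫⁻ y, k y * g y ∂μ) ^ 2 ≤ (∫⁻ y, k y ∂μ) * ∫⁻ y, k y * g y ^ 2 ∂μ := by
  have h := ENNReal.lintegral_mul_le_Lp_mul_Lq (μ.withDensity k)
    Real.HolderConjugate.two_two (f := fun _ ↦ 1) (g := g) aemeasurable_const hg.aemeasurable
  have h2 : ((∫⁻ a, ((fun _ ↦ 1 : α → ℝ≥0∞) * g) a ∂μ.withDensity k)) ^ 2 ≤
      (∫⁻ _, 1 ∂μ.withDensity k) * ∫⁻ y, g y ^ 2 ∂μ.withDensity k := by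
    refine (pow_le_pow_left' h 2).trans (le_of_eq ?_)
    rw [mul_pow, ← ENNReal.rpow_natCast, ← ENNReal.rpow_natCast, ← ENNReal.rpow_mul,
      ← ENNReal.rpow_mul]
    norm_num
  rw [lintegral_withDensity_eq_lintegral_mul _ hk (measurable_const.mul hg),
    lintegral_withDensity_eq_lintegral_mul _ hk measurable_const,
    lintegral_withDensity_eq_lintegral_mul _ hk (hg.pow_const 2)] at h2
  simpa using h2

theorem eLpNorm_two_sq (f : α → 𝕜) : eLpNorm f 2 μ ^ 2 = ∫⁻ x, ‖f x‖ₑ ^ 2 ∂μ := by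
  simpa using eLpNorm_nnreal_pow_eq_lintegral (f := f) (μ := μ) (p := 2) two_ne_zero

namespace IsSchurKernel

variable {K K' : α → β → 𝕜} {A A' : ℝ≥0}

theorem const_mul (hK : IsSchurKernel μ ν K A) (c : 𝕜) :
    IsSchurKernel μ ν (fun x y ↦ c * K x y) (‖c‖₊ * A) where
  measurable := hK.measurable.const_mul c
  lintegral_right_le x := by
    simp only [enorm_mul]
    rw [lintegral_const_mul' _ _ enorm_ne_top, ENNReal.coe_mul]
    exact mul_le_mul_right (hK.lintegral_right_le x) _
  lintegral_left_le y := by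
    simp only [enorm_mul]
    rw [lintegral_const_mul' _ _ enorm_ne_top, ENNReal.coe_mul]
    exact mul_le_mul_right (hK.lintegral_left_le y) _

theorem sub (hK : IsSchurKernel μ ν K A) (hK' : IsSchurKernel μ ν K' A') :
    IsSchurKernel μ ν (fun x y ↦ K x y - K' x y) (A + A') where
  measurable := hK.measurable.sub hK'.measurable
  lintegral_right_le x := by
    refine (lintegral_mono fun y ↦ enorm_sub_le).trans ?_
    have hm : Measurable fun y ↦ ‖K x y‖ₑ := (hK.measurable.comp measurable_prodMk_left).enorm
    rw [lintegral_add_left hm, ENNReal.coe_add]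
    exact add_le_add (hK.lintegral_right_le x) (hK'.lintegral_right_le x)
  lintegral_left_le y := by
    refine (lintegral_mono fun x ↦ enorm_sub_le).trans ?_
    have hm : Measurable fun x ↦ ‖K x y‖ₑ := (hK.measurable.comp measurable_prodMk_right).enorm
    rw [lintegral_add_left hm, ENNReal.coe_add]
    exact add_le_add (hK.lintegral_left_le y) (hK'.lintegral_left_le y)

theorem of_bounded {S : Set α} {S' : Set β} {B C : ℝ≥0} (hm : Measurable (Function.uncurry K))
    (hS : MeasurableSet S) (hS' : MeasurableSet S') (hμ : μ S ≤ B) (hν : ν S' ≤ B)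
    (hC : ∀ x y, ‖K x y‖ ≤ C) (h0 : ∀ x y, (x, y) ∉ S ×ˢ S' → K x y = 0) :
    IsSchurKernel μ ν K (C * B) where
  measurable := hm
  lintegral_right_le x := by
    have hle : ∀ y, ‖K x y‖ₑ ≤ S'.indicator (fun _ ↦ (C : ℝ≥0∞)) y := fun y ↦ by
      by_cases hy : y ∈ S'
      · rw [indicator_of_mem hy]
        exact ENNReal.coe_le_coe.2 (hC x y)
      · rw [h0 x y fun h ↦ hy h.2, enorm_zero]
        exact zero_le
    refine (lintegral_mono hle).trans ?_
    rw [lintegral_indicator_const hS', ENNReal.coe_mul]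
    exact mul_le_mul_right hν _
  lintegral_left_le y := by
    have hle : ∀ x, ‖K x y‖ₑ ≤ S.indicator (fun _ ↦ (C : ℝ≥0∞)) x := fun x ↦ by
      by_cases hx : x ∈ S
      · rw [indicator_of_mem hx]
        exact ENNReal.coe_le_coe.2 (hC x y)
      · rw [h0 x y fun h ↦ hx h.1, enorm_zero]
        exact zero_le
    refine (lintegral_mono hle).trans ?_
    rw [lintegral_indicator_const hS, ENNReal.coe_mul]
    exact mul_le_mul_right hμ _

theorem measurable_mul (hK : IsSchurKernel μ ν K A) (f : Lp 𝕜 2 ν) :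
    Measurable (Function.uncurry fun x y ↦ K x y * f y) :=
  hK.measurable.mul ((Lp.stronglyMeasurable f).measurable.comp measurable_snd)

variable [SFinite ν]

theorem measurable_lintegral (hK : IsSchurKernel μ ν K A) (f : Lp 𝕜 2 ν) :
    Measurable fun x ↦ ∫⁻ y, ‖K x y‖ₑ * ‖f y‖ₑ ∂ν :=
  Measurable.lintegral_prod_right (hK.measurable.enorm.mul
    ((Lp.stronglyMeasurable f).measurable.enorm.comp measurable_snd))

variable [SFinite μ]

theorem lintegral_sq_le (hK : IsSchurKernel μ ν K A) {g : β → ℝ≥0∞} (hg : Measurable g) :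
    ∫⁻ x, (∫⁻ y, ‖K x y‖ₑ * g y ∂ν) ^ 2 ∂μ ≤ A ^ 2 * ∫⁻ y, g y ^ 2 ∂ν := by
  have hm := hK.measurable.enorm
  calc ∫⁻ x, (∫⁻ y, ‖K x y‖ₑ * g y ∂ν) ^ 2 ∂μ
      ≤ ∫⁻ x, A * ∫⁻ y, ‖K x y‖ₑ * g y ^ 2 ∂ν ∂μ := by
        refine lintegral_mono fun x ↦ ?_
        refine (sq_lintegral_mul_le ν (hm.comp measurable_prodMk_left) hg).trans ?_
        exact mul_le_mul_left (hK.lintegral_right_le x) _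
    _ = A * ∫⁻ x, ∫⁻ y, ‖K x y‖ₑ * g y ^ 2 ∂ν ∂μ := by
        rw [lintegral_const_mul' _ _ ENNReal.coe_ne_top]
    _ = A * ∫⁻ y, ∫⁻ x, ‖K x y‖ₑ * g y ^ 2 ∂μ ∂ν := by
        rw [lintegral_lintegral_swap]
        exact (hm.mul ((hg.pow_const 2).comp measurable_snd)).aemeasurable
    _ = A * ∫⁻ y, (∫⁻ x, ‖K x y‖ₑ ∂μ) * g y ^ 2 ∂ν := by
        congr 1
        refine lintegral_congr fun y ↦ ?_
        exact lintegral_mul_const _ (hm.comp measurable_prodMk_right)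
    _ ≤ A * ∫⁻ y, A * g y ^ 2 ∂ν := by
        gcongr with y
        exact hK.lintegral_left_le y
    _ = A ^ 2 * ∫⁻ y, g y ^ 2 ∂ν := by
        rw [lintegral_const_mul' _ _ ENNReal.coe_ne_top, ← mul_assoc, sq]

theorem lintegral_sq_lt_top (hK : IsSchurKernel μ ν K A) (f : Lp 𝕜 2 ν) :
    ∫⁻ x, (∫⁻ y, ‖K x y‖ₑ * ‖f y‖ₑ ∂ν) ^ 2 ∂μ < ⊤ := by
  refine (hK.lintegral_sq_le (Lp.stronglyMeasurable f).measurable.enorm).trans_lt ?_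
  rw [← eLpNorm_two_sq]
  exact ENNReal.mul_lt_top (ENNReal.pow_lt_top ENNReal.coe_lt_top)
    (ENNReal.pow_lt_top (Lp.eLpNorm_lt_top f))

theorem ae_integrable (hK : IsSchurKernel μ ν K A) (f : Lp 𝕜 2 ν) :
    ∀ᵐ x ∂μ, Integrable (fun y ↦ K x y * f y) ν := by
  filter_upwards [ae_lt_top ((hK.measurable_lintegral f).pow_const 2)
    (hK.lintegral_sq_lt_top f).ne] with x hx
  refine ⟨((hK.measurable_mul f).comp measurable_prodMk_left).aestronglyMeasurable, ?_⟩
  rw [hasFiniteIntegral_iff_enorm]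
  simp only [enorm_mul]
  exact (ENNReal.pow_lt_top_iff.1 hx).resolve_right two_ne_zero

theorem eLpNorm_integral_le (hK : IsSchurKernel μ ν K A) (f : Lp 𝕜 2 ν) :
    eLpNorm (fun x ↦ ∫ y, K x y * f y ∂ν) 2 μ ≤ A * eLpNorm f 2 ν := by
  rw [← ENNReal.pow_le_pow_left_iff two_ne_zero, mul_pow, eLpNorm_two_sq, eLpNorm_two_sq]
  refine le_trans (lintegral_mono fun x ↦ ?_)
    (hK.lintegral_sq_le (Lp.stronglyMeasurable f).measurable.enorm)
  refine pow_le_pow_left' ((enorm_integral_le_lintegral_enorm _).trans (le_of_eq ?_)) 2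
  simp only [enorm_mul]

theorem memLp_integral (hK : IsSchurKernel μ ν K A) (f : Lp 𝕜 2 ν) :
    MemLp (fun x ↦ ∫ y, K x y * f y ∂ν) 2 μ :=
  ⟨(hK.measurable_mul f).stronglyMeasurable.integral_prod_right.aestronglyMeasurable,
    (hK.eLpNorm_integral_le f).trans_lt
      (ENNReal.mul_lt_top ENNReal.coe_lt_top (Lp.eLpNorm_lt_top f))⟩

theorem toReal_eLpNorm_integral_le (hK : IsSchurKernel μ ν K A) (f : Lp 𝕜 2 ν) :
    (eLpNorm (fun x ↦ ∫ y, K x y * f y ∂ν) 2 μ).toReal ≤ A * ‖f‖ := by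
  rw [Lp.norm_def]
  simpa [ENNReal.toReal_mul] using ENNReal.toReal_mono (ENNReal.mul_lt_top ENNReal.coe_lt_top
    (Lp.eLpNorm_lt_top f)).ne (hK.eLpNorm_integral_le f)

theorem norm_le (hK : IsSchurKernel μ ν K A) {L : Lp 𝕜 2 ν →L[𝕜] Lp 𝕜 2 μ}
    (hL : HasKernel L K) : ‖L‖ ≤ A := by
  refine L.opNorm_le_bound A.2 fun f ↦ ?_
  rw [Lp.norm_def (L f), eLpNorm_congr_ae (hL f)]
  exact hK.toReal_eLpNorm_integral_le f

theorem exists_hasKernel (hK : IsSchurKernel μ ν K A) :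
    ∃ L : Lp 𝕜 2 ν →L[𝕜] Lp 𝕜 2 μ, HasKernel L K := by
  let T : Lp 𝕜 2 ν →ₗ[𝕜] Lp 𝕜 2 μ :=
    { toFun := fun f ↦ (hK.memLp_integral f).toLp
      map_add' := fun f g ↦ by
        refine (MemLp.toLp_congr _ ((hK.memLp_integral f).add (hK.memLp_integral g)) ?_).trans
          (MemLp.toLp_add _ _)
        filter_upwards [hK.ae_integrable f, hK.ae_integrable g] with x hf hg
        rw [Pi.add_apply, ← integral_add hf hg]
        refine integral_congr_ae ?_
        filter_upwards [Lp.coeFn_add f g] with y hy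
        rw [hy, Pi.add_apply, mul_add]
      map_smul' := fun c f ↦ by
        refine (MemLp.toLp_congr _ ((hK.memLp_integral f).const_smul c) ?_).trans
          (MemLp.toLp_const_smul _ _)
        filter_upwards with x
        rw [Pi.smul_apply, smul_eq_mul, ← integral_const_mul]
        refine integral_congr_ae ?_
        filter_upwards [Lp.coeFn_smul c f] with y hy
        rw [hy, Pi.smul_apply, smul_eq_mul, mul_left_comm] }
  refine ⟨T.mkContinuous A fun f ↦ ?_, fun f ↦ (hK.memLp_integral f).coeFn_toLp⟩
  exact (Lp.norm_toLp _ (hK.memLp_integral f)).trans_le (hK.toReal_eLpNorm_integral_le f)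

theorem integrable_prod (hK : IsSchurKernel μ ν K A) (f : Lp 𝕜 2 ν) {φ : α → 𝕜}
    (hφ : Measurable φ) (hφ2 : MemLp φ 2 μ) :
    Integrable (fun p : α × β ↦ φ p.1 * (K p.1 p.2 * f p.2)) (μ.prod ν) := by
  have hm : Measurable fun p : α × β ↦ φ p.1 * (K p.1 p.2 * f p.2) :=
    (hφ.comp measurable_fst).mul (hK.measurable_mul f)
  refine ⟨hm.aestronglyMeasurable, ?_⟩
  have hφ2' : ∫⁻ x, ‖φ x‖ₑ ^ 2 ∂μ < ⊤ := by
    rw [← eLpNorm_two_sq]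
    exact ENNReal.pow_lt_top hφ2.2
  have hmul_le (a b : ℝ≥0∞) : a * b ≤ a ^ 2 + b ^ 2 := by
    rcases le_total a b with h | h
    · exact (mul_le_mul_left h b).trans ((sq b).symm.trans_le le_add_self)
    · exact (mul_le_mul_right h a).trans ((sq a).symm.trans_le le_self_add)
  rw [hasFiniteIntegral_iff_enorm, lintegral_prod _ hm.enorm.aemeasurable]
  simp only [enorm_mul]
  calc ∫⁻ x, ∫⁻ y, ‖φ x‖ₑ * (‖K x y‖ₑ * ‖f y‖ₑ) ∂ν ∂μ
      = ∫⁻ x, ‖φ x‖ₑ * ∫⁻ y, ‖K x y‖ₑ * ‖f y‖ₑ ∂ν ∂μ :=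
        lintegral_congr fun x ↦ lintegral_const_mul' _ _ enorm_ne_top
    _ ≤ ∫⁻ x, ‖φ x‖ₑ ^ 2 + (∫⁻ y, ‖K x y‖ₑ * ‖f y‖ₑ ∂ν) ^ 2 ∂μ :=
        lintegral_mono fun x ↦ hmul_le _ _
    _ = ∫⁻ x, ‖φ x‖ₑ ^ 2 ∂μ + ∫⁻ x, (∫⁻ y, ‖K x y‖ₑ * ‖f y‖ₑ ∂ν) ^ 2 ∂μ :=
        lintegral_add_left (hφ.enorm.pow_const 2) _
    _ < ⊤ := ENNReal.add_lt_top.2 ⟨hφ2', hK.lintegral_sq_lt_top f⟩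

theorem integral_apply_mul (hK : IsSchurKernel μ ν K A) {L : Lp 𝕜 2 ν →L[𝕜] Lp 𝕜 2 μ}
    (hL : HasKernel L K) (f : Lp 𝕜 2 ν) {φ : α → 𝕜} (hφ : Measurable φ) (hφ2 : MemLp φ 2 μ) :
    ∫ x, L f x * φ x ∂μ = ∫ y, (∫ x, K x y * φ x ∂μ) * f y ∂ν := by
  calc ∫ x, L f x * φ x ∂μ = ∫ x, ∫ y, φ x * (K x y * f y) ∂ν ∂μ := by
        refine integral_congr_ae ?_
        filter_upwards [hL f] with x hx
        rw [hx, integral_const_mul, mul_comm]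
    _ = ∫ y, ∫ x, φ x * (K x y * f y) ∂μ ∂ν :=
        integral_integral_swap (hK.integrable_prod f hφ hφ2)
    _ = ∫ y, (∫ x, K x y * φ x ∂μ) * f y ∂ν := by
        refine integral_congr_ae (.of_forall fun y ↦ ?_)
        simp only [← integral_mul_const, mul_left_comm (φ _), mul_comm (φ _), mul_assoc]

end IsSchurKernel

theorem HasKernel.sub [SFinite μ] [SFinite ν] {K K' : α → β → 𝕜} {A A' : ℝ≥0}
    {L L' : Lp 𝕜 2 ν →L[𝕜] Lp 𝕜 2 μ} (h : HasKernel L K) (h' : HasKernel L' K')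
    (hK : IsSchurKernel μ ν K A) (hK' : IsSchurKernel μ ν K' A') :
    HasKernel (L - L') fun x y ↦ K x y - K' x y := by
  intro f
  filter_upwards [h f, h' f, Lp.coeFn_sub (L f) (L' f), hK.ae_integrable f, hK'.ae_integrable f]
    with x h1 h2 h3 h4 h5
  rw [_root_.sub_apply, h3, Pi.sub_apply, h1, h2, ← integral_sub h4 h5]
  simp only [sub_mul]

end SchurTest

/-! ### Holomorphic families of integral operators -/

theorem norm_sub_sub_mul_deriv_le {g : ℂ → ℂ} (hg : Differentiable ℂ g) {c z : ℂ} {C : ℝ}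
    (hC : ∀ w ∈ Metric.closedBall c 2, ‖g w‖ ≤ C) (hz : z ∈ Metric.closedBall c 1) :
    ‖g z - g c - (z - c) * deriv g c‖ ≤ 2 * C * ‖z - c‖ ^ 2 := by
  have hC0 : 0 ≤ C := (norm_nonneg _).trans (hC c (by simp))
  have hg' : Differentiable ℂ (deriv g) := fun w ↦ (hg.analyticAt w).deriv.differentiableAt
  have hderiv2 : ∀ w ∈ Metric.closedBall c 1, ‖deriv (deriv g) w‖ ≤ 2 * C := fun w hw ↦ by
    have h := Complex.norm_iteratedDeriv_le_of_forall_mem_sphere_norm_le 2 one_pos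
      (hg.diffContOnCl (s := Metric.ball w 1)) (C := C) fun y hy ↦ hC y <| by
        rw [Metric.mem_closedBall] at hw ⊢
        rw [Metric.mem_sphere] at hy
        linarith [dist_triangle y w c]
    simpa [iteratedDeriv_succ, iteratedDeriv_one] using h
  have hderiv1 : ∀ w ∈ Metric.closedBall c 1, ‖deriv g w - deriv g c‖ ≤ 2 * C * ‖w - c‖ :=
    fun w hw ↦ (convex_closedBall c 1).norm_image_sub_le_of_norm_deriv_le (fun x _ ↦ hg' x)
      hderiv2 (by simp) hw
  have hsub : Metric.closedBall c ‖z - c‖ ⊆ Metric.closedBall c 1 :=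
    Metric.closedBall_subset_closedBall (by simpa [dist_eq_norm] using hz)
  have hrem (w : ℂ) : HasDerivAt (fun w ↦ g w - (w - c) * deriv g c) (deriv g w - deriv g c) w :=
    ((hg w).hasDerivAt.sub (((hasDerivAt_id w).sub_const c).mul_const (deriv g c))).congr_deriv
      (by rw [one_mul])
  have h := (convex_closedBall c ‖z - c‖).norm_image_sub_le_of_norm_hasDerivWithin_le
    (C := 2 * C * ‖z - c‖) (fun w _ ↦ (hrem w).hasDerivWithinAt) (fun w hw ↦
      (hderiv1 w (hsub hw)).trans (by gcongr; simpa [dist_eq_norm] using hw))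
    (x := c) (y := z) (by simp) (by simp [dist_eq_norm])
  convert h using 1
  · congr 1
    ring
  · ring

section HolomorphicFamily

variable {α β : Type*} [MeasurableSpace α] [MeasurableSpace β]

/-- A family of kernels depending holomorphically and locally boundedly on a parameter in `ℂ`, all
supported in the rectangle `S ×ˢ S'`. -/
structure IsEntireKernelFamily (S : Set α) (S' : Set β) (K : ℂ → α → β → ℂ) : Prop where
  measurable : ∀ lam, Measurable (Function.uncurry (K lam))
  eq_zero : ∀ lam x y, (x, y) ∉ S ×ˢ S' → K lam x y = 0
  differentiable : ∀ x y, Differentiable ℂ fun lam ↦ K lam x y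
  exists_bound : ∀ r : ℝ, ∃ C : ℝ≥0, ∀ lam ∈ Metric.closedBall 0 r, ∀ x y, ‖K lam x y‖ ≤ C

namespace IsEntireKernelFamily

variable {S : Set α} {S' : Set β} {K : ℂ → α → β → ℂ}

theorem exists_bound_closedBall (hK : IsEntireKernelFamily S S' K) (c : ℂ) :
    ∃ C : ℝ≥0, ∀ lam ∈ Metric.closedBall c 2, ∀ x y, ‖K lam x y‖ ≤ C := by
  obtain ⟨C, hC⟩ := hK.exists_bound (2 + dist c 0)
  exact ⟨C, fun lam hlam ↦ hC lam (Metric.closedBall_subset_closedBall' le_rfl hlam)⟩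

theorem measurable_deriv (hK : IsEntireKernelFamily S S' K) (c : ℂ) :
    Measurable (Function.uncurry fun x y ↦ deriv (fun lam ↦ K lam x y) c) := by
  let h : ℕ → ℂ := fun n ↦ 1 / ((n : ℂ) + 1)
  have hh : Tendsto h atTop (𝓝[≠] 0) := tendsto_nhdsWithin_iff.2
    ⟨tendsto_one_div_add_atTop_nhds_zero_nat, .of_forall fun n ↦ by
      simpa [h] using Nat.cast_add_one_ne_zero (R := ℂ) n⟩
  refine measurable_of_tendsto_metrizable
    (f := fun n (p : α × β) ↦ (h n)⁻¹ • (K (c + h n) p.1 p.2 - K c p.1 p.2))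
    (fun n ↦ ((hK.measurable _).sub (hK.measurable _)).const_smul (h n)⁻¹) ?_
  rw [tendsto_pi_nhds]
  exact fun p ↦ (hK.differentiable p.1 p.2 c).hasDerivAt.tendsto_slope_zero.comp hh

theorem norm_deriv_le {c : ℂ} {C : ℝ≥0} (hK : IsEntireKernelFamily S S' K)
    (hC : ∀ lam ∈ Metric.closedBall c 2, ∀ x y, ‖K lam x y‖ ≤ C) (x : α) (y : β) :
    ‖deriv (fun lam ↦ K lam x y) c‖ ≤ C := by
  have h := Complex.norm_deriv_le_of_forall_mem_sphere_norm_le one_pos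
    ((hK.differentiable x y).diffContOnCl (s := Metric.ball c 1)) fun w hw ↦ hC w
      (Metric.closedBall_subset_closedBall one_le_two (Metric.sphere_subset_closedBall hw)) x y
  simpa using h

variable {μ : Measure α} {ν : Measure β}

theorem exists_measure_le (hμ : μ S ≠ ⊤) (hν : ν S' ≠ ⊤) : ∃ B : ℝ≥0, μ S ≤ B ∧ ν S' ≤ B :=
  ⟨max (μ S).toNNReal (ν S').toNNReal, by simp [hμ], by simp [hν]⟩

variable [SFinite μ] [SFinite ν]

theorem differentiable_of_hasKernel (hK : IsEntireKernelFamily S S' K) (hS : MeasurableSet S)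
    (hS' : MeasurableSet S') (hμ : μ S ≠ ⊤) (hν : ν S' ≠ ⊤) {T : ℂ → Lp ℂ 2 ν →L[ℂ] Lp ℂ 2 μ}
    (hT : ∀ lam, HasKernel (T lam) (K lam)) : Differentiable ℂ T := by
  intro c
  obtain ⟨C, hC⟩ := hK.exists_bound_closedBall c
  obtain ⟨B, hBμ, hBν⟩ := exists_measure_le hμ hν
  have hz_bound {z : ℂ} (hz : z ∈ Metric.closedBall c 2) : IsSchurKernel μ ν (K z) (C * B) :=
    .of_bounded (hK.measurable z) hS hS' hBμ hBν (hC z hz) (hK.eq_zero z)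
  let K' : α → β → ℂ := fun x y ↦ deriv (fun lam ↦ K lam x y) c
  have hK'0 (x y) (h : (x, y) ∉ S ×ˢ S') : K' x y = 0 := by
    simp only [K', hK.eq_zero _ x y h, deriv_const]
  have hK' : IsSchurKernel μ ν K' (C * B) :=
    .of_bounded (hK.measurable_deriv c) hS hS' hBμ hBν (hK.norm_deriv_le hC) hK'0
  obtain ⟨L, hL⟩ := hK'.exists_hasKernel
  suffices HasDerivAt T L c from this.differentiableAt
  rw [hasDerivAt_iff_isLittleO]
  refine Asymptotics.IsBigO.trans_isLittleO (g := fun z ↦ ‖z - c‖ ^ 2)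
    (.of_bound (2 * C * B) ?_) (Asymptotics.isLittleO_pow_sub_sub c one_lt_two)
  filter_upwards [Metric.closedBall_mem_nhds c one_pos] with z hz
  have hz2 := hz_bound (Metric.closedBall_subset_closedBall one_le_two hz)
  have hc2 := hz_bound (Metric.mem_closedBall_self zero_le_two)
  have hrem := ((hT z).sub (hT c) hz2 hc2).sub (hL.const_smul (z - c)) (hz2.sub hc2)
    (hK'.const_mul (z - c))
  have hrem_schur : IsSchurKernel μ ν (fun x y ↦ K z x y - K c x y - (z - c) * K' x y)
      (2 * C * ‖z - c‖₊ ^ 2 * B) :=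
    .of_bounded (((hK.measurable z).sub (hK.measurable c)).sub
        ((hK.measurable_deriv c).const_mul _)) hS hS' hBμ hBν
      (fun x y ↦ norm_sub_sub_mul_deriv_le (hK.differentiable x y) (fun w hw ↦ hC w hw x y) hz)
      (fun x y h ↦ by simp [hK.eq_zero _ _ _ h, hK'0 _ _ h])
  refine (hrem_schur.norm_le hrem).trans (le_of_eq ?_)
  push_cast
  rw [norm_pow, norm_norm]
  ring

theorem exists_differentiable_hasKernel (hK : IsEntireKernelFamily S S' K) (hS : MeasurableSet S)
    (hS' : MeasurableSet S') (hμ : μ S ≠ ⊤) (hν : ν S' ≠ ⊤) :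
    ∃ T : ℂ → Lp ℂ 2 ν →L[ℂ] Lp ℂ 2 μ, Differentiable ℂ T ∧ ∀ lam, HasKernel (T lam) (K lam) := by
  obtain ⟨B, hBμ, hBν⟩ := exists_measure_le hμ hν
  have hT (lam : ℂ) : ∃ T : Lp ℂ 2 ν →L[ℂ] Lp ℂ 2 μ, HasKernel T (K lam) := by
    obtain ⟨C, hC⟩ := hK.exists_bound_closedBall lam
    exact (IsSchurKernel.of_bounded (hK.measurable lam) hS hS' hBμ hBν
      (hC lam (by simp)) (hK.eq_zero lam)).exists_hasKernel
  choose T hT using hT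
  exact ⟨T, hK.differentiable_of_hasKernel hS hS' hμ hν hT, hT⟩

end IsEntireKernelFamily

end HolomorphicFamily

/-! ### Weak derivatives -/

theorem absolutelyContinuousOnInterval_primitive {w : ℝ → ℂ} (hw : LocallyIntegrable w volume)
    {a b c : ℝ} (hc : c ∈ uIcc a b) :
    AbsolutelyContinuousOnInterval (fun x ↦ ∫ t in c..x, w t) a b := by
  have hi (x y : ℝ) : IntervalIntegrable w volume x y :=
    (hw.integrableOn_isCompact isCompact_uIcc).intervalIntegrable
  have hre (x y : ℝ) : IntervalIntegrable (fun t ↦ (w t).re) volume x y :=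
    ⟨(hi x y).1.re, (hi x y).2.re⟩
  have him (x y : ℝ) : IntervalIntegrable (fun t ↦ (w t).im) volume x y :=
    ⟨(hi x y).1.im, (hi x y).2.im⟩
  have hconst (z : ℂ) : AbsolutelyContinuousOnInterval (fun _ ↦ z) a b :=
    contDiffOn_const.absolutelyContinuousOnInterval
  have hsplit : (fun x ↦ ∫ t in c..x, w t) = fun x ↦
      (∫ t in c..x, (w t).re) • (1 : ℂ) + (∫ t in c..x, (w t).im) • I := by
    funext x
    have h1 : IntervalIntegrable (fun t ↦ ((w t).re : ℂ)) volume c x :=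
      ⟨(hre c x).1.ofReal, (hre c x).2.ofReal⟩
    have h2 : IntervalIntegrable (fun t ↦ ((w t).im : ℂ)) volume c x :=
      ⟨(him c x).1.ofReal, (him c x).2.ofReal⟩
    simp only [Complex.real_smul, ← intervalIntegral.integral_ofReal,
      ← intervalIntegral.integral_mul_const]
    rw [← intervalIntegral.integral_add (h1.mul_const _) (h2.mul_const _)]
    simp only [mul_one, Complex.re_add_im]
  rw [hsplit]
  exact (((hre a b).absolutelyContinuousOnInterval_intervalIntegral hc).smul (hconst 1)).add
    (((him a b).absolutelyContinuousOnInterval_intervalIntegral hc).smul (hconst I))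

theorem integral_eq_sub_of_ae_hasDerivAt {F F' : ℝ → ℂ} {a b : ℝ}
    (hF : AbsolutelyContinuousOnInterval F a b) (hF' : LocallyIntegrable F' volume)
    (hd : ∀ᵐ x, HasDerivAt F (F' x) x) : ∫ x in a..b, F' x = F b - F a := by
  have hprim := absolutelyContinuousOnInterval_primitive hF' (a := a) (b := b) left_mem_uIcc
  obtain ⟨C, hC⟩ := (hF.sub hprim).const_of_ae_hasDerivAt_zero <| by
    filter_upwards [hd, LocallyIntegrable.ae_hasDerivAt_integral hF'] with x hx hx' _
    exact (hx.sub (hx' a)).congr_deriv (sub_self _)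
  have ha := hC a left_mem_uIcc
  have hb := hC b right_mem_uIcc
  simp only [Pi.sub_apply, intervalIntegral.integral_same] at ha hb
  linear_combination ha - hb

theorem integral_primitive_mul_deriv {w φ : ℝ → ℂ} (hw : LocallyIntegrable w volume)
    (hφ : ContDiff ℝ 1 φ) (hφc : HasCompactSupport φ) (a : ℝ) :
    ∫ x, (∫ t in a..x, w t) * deriv φ x = -∫ x, w x * φ x := by
  obtain ⟨R, hR0, hR⟩ := hφc.isCompact.isBounded.subset_ball_lt 0 a
  rw [Real.ball_eq_Ioo] at hR
  have hφ0 {x : ℝ} (hx : x ∉ Ioo (a - R) (a + R)) : φ x = 0 :=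
    image_eq_zero_of_notMem_tsupport fun h ↦ hx (hR h)
  have hwφ : Integrable fun x ↦ w x * φ x := by
    simpa only [smul_eq_mul] using
      hw.integrable_smul_right_of_hasCompactSupport hφ.continuous hφc
  have hWφ : Integrable fun x ↦ (∫ t in a..x, w t) * deriv φ x :=
    ((intervalIntegral.continuous_primitive (fun _ _ ↦ (hw.integrableOn_isCompact
      isCompact_uIcc).intervalIntegrable) a).mul
      (hφ.continuous_deriv le_rfl)).integrable_of_hasCompactSupport hφc.deriv.mul_left
  have hsupp : Function.support (fun x ↦ w x * φ x + (∫ t in a..x, w t) * deriv φ x) ⊆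
      Ioc (a - R) (a + R) := fun x hx ↦ Ioo_subset_Ioc_self <| hR <| by
    contrapose! hx
    simp [image_eq_zero_of_notMem_tsupport hx,
      image_eq_zero_of_notMem_tsupport fun h ↦ hx (tsupport_deriv_subset h)]
  have hac : AbsolutelyContinuousOnInterval (fun x ↦ (∫ t in a..x, w t) * φ x) (a - R) (a + R) :=
    (absolutelyContinuousOnInterval_primitive hw
      (mem_uIcc_of_le (by linarith) (by linarith))).smul
      hφ.contDiffOn.absolutelyContinuousOnInterval
  have hFTC := integral_eq_sub_of_ae_hasDerivAt hac (hwφ.fun_add hWφ).locallyIntegrable <| by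
    filter_upwards [LocallyIntegrable.ae_hasDerivAt_integral hw] with x hx
    exact (hx a).mul (hφ.differentiable one_ne_zero x).hasDerivAt
  rw [hφ0 (fun h ↦ lt_irrefl _ h.1), hφ0 (fun h ↦ lt_irrefl _ h.2), mul_zero, mul_zero, sub_self,
    intervalIntegral.integral_eq_integral_of_support_subset hsupp,
    integral_add hwφ hWφ] at hFTC
  linear_combination hFTC

theorem exists_hasCompactSupport_deriv_eq {θ : ℝ → ℝ} (hθ : ContDiff ℝ ∞ θ)
    (hθc : HasCompactSupport θ) (hθ0 : ∫ x, θ x = 0) :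
    ∃ Θ : ℝ → ℝ, ContDiff ℝ ∞ Θ ∧ HasCompactSupport Θ ∧ deriv Θ = θ := by
  obtain ⟨R, hR⟩ := (Metric.isBounded_iff_subset_ball (0 : ℝ)).1 hθc.isCompact.isBounded
  rw [Real.ball_eq_Ioo, zero_sub, zero_add] at hR
  have hsupp : Function.support θ ⊆ Ioo (-R) R := (subset_tsupport θ).trans hR
  set Θ : ℝ → ℝ := fun x ↦ ∫ t in -R..x, θ t
  have hd (x : ℝ) : HasDerivAt Θ (θ x) x :=
    (hθ.continuous.integral_hasStrictDerivAt (-R) x).hasDerivAt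
  have hderiv : deriv Θ = θ := funext fun x ↦ (hd x).deriv
  refine ⟨Θ, contDiff_infty_iff_deriv.2 ⟨fun x ↦ (hd x).differentiableAt, by rwa [hderiv]⟩,
    .intro (isCompact_Icc (a := -R) (b := R)) fun x hx ↦ ?_, hderiv⟩
  rw [mem_Icc, not_and_or, not_le, not_le] at hx
  rcases hx with hx | hx
  · refine intervalIntegral.integral_zero_ae (.of_forall fun t ht ↦ ?_)
    rw [uIoc_of_ge hx.le] at ht
    exact Function.notMem_support.1 fun h ↦ (hsupp h).1.not_ge ht.2
  · exact (intervalIntegral.integral_eq_integral_of_support_subset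
      (hsupp.trans fun t ht ↦ ⟨ht.1, ht.2.le.trans hx.le⟩)).trans hθ0

/-- Du Bois-Reymond's lemma: a test function becomes the derivative of a test function once a
multiple of a fixed bump of mass one is subtracted. -/
theorem ae_eq_const_of_integral_mul_deriv_eq_zero {h : ℝ → ℂ} (hh : LocallyIntegrable h volume)
    (h0 : ∀ φ : ℝ → ℂ, ContDiff ℝ ∞ φ → HasCompactSupport φ → ∫ x, h x * deriv φ x = 0) :
    ∃ c : ℂ, ∀ᵐ x : ℝ, h x = c := by
  let B : ContDiffBump (0 : ℝ) := ⟨1, 2, one_pos, one_lt_two⟩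
  set χ : ℝ → ℝ := B.normed volume
  have hχ : ContDiff ℝ ∞ χ := B.contDiff_normed
  have hχc : HasCompactSupport χ := B.hasCompactSupport_normed
  have hχi : Integrable χ := hχ.continuous.integrable_of_hasCompactSupport hχc
  have hχh : Integrable fun x ↦ χ x • h x :=
    hh.integrable_smul_left_of_hasCompactSupport hχ.continuous hχc
  set c := ∫ x, χ x • h x with hc
  refine ⟨c, ?_⟩
  suffices ∀ᵐ x : ℝ, h x - c = 0 from this.mono fun x hx ↦ sub_eq_zero.1 hx
  refine ae_eq_zero_of_integral_contDiff_smul_eq_zero (hh.sub (locallyIntegrable_const c)) ?_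
  intro ψ hψ hψc
  have hψi : Integrable ψ := hψ.continuous.integrable_of_hasCompactSupport hψc
  have hψh : Integrable fun x ↦ ψ x • h x :=
    hh.integrable_smul_left_of_hasCompactSupport hψ.continuous hψc
  set m := ∫ x, ψ x
  obtain ⟨Θ, hΘ, hΘc, hΘd⟩ := exists_hasCompactSupport_deriv_eq
    (hψ.sub (contDiff_const.mul hχ : ContDiff ℝ ∞ fun x ↦ m * χ x)) (hψc.sub hχc.mul_left) <| by
      rw [integral_sub hψi (hχi.const_mul m), integral_const_mul, B.integral_normed, mul_one,
        sub_self]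
  have hd (x : ℝ) : deriv (fun x ↦ (Θ x : ℂ)) x = ψ x - m * χ x := by
    have := (hΘ.differentiable (by simp) x).hasDerivAt.ofReal_comp.deriv
    rw [this, hΘd]
    push_cast
    rfl
  calc ∫ x, ψ x • (h x - c) = (∫ x, ψ x • h x) - m * c := by
        simp only [smul_sub]
        rw [integral_sub hψh (hψi.smul_const c), integral_smul_const, Complex.real_smul]
    _ = ∫ x, h x * deriv (fun x ↦ (Θ x : ℂ)) x := by
        rw [hc, ← integral_const_mul, ← integral_sub hψh (hχh.const_mul _)]
        refine integral_congr_ae (.of_forall fun x ↦ ?_)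
        simp only [hd, Complex.real_smul]
        ring
    _ = 0 := h0 _ (Complex.ofRealCLM.contDiff.comp hΘ) (hΘc.comp_left Complex.ofReal_zero)

theorem integral_Iic_of_hasDerivAt_off_countable {F F' : ℝ → ℂ} {s : Set ℝ} (hs : s.Countable)
    (hc : Continuous F) (hd : ∀ x ∉ s, HasDerivAt F (F' x) x) (hi : Integrable F')
    (hF : HasCompactSupport F) (y : ℝ) : ∫ x in Iic y, F' x = F y := by
  have h1 := intervalIntegral_tendsto_integral_Iic (μ := volume) y hi.integrableOn tendsto_id
  have h2 : Tendsto (fun R ↦ F y - F R) atBot (𝓝 (F y - 0)) :=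
    (hF.is_zero_at_infty.mono_left atBot_le_cocompact).const_sub _
  rw [sub_zero] at h2
  refine tendsto_nhds_unique (h1.congr fun R ↦ ?_) h2
  exact integral_eq_of_hasDerivAt_off_countable F F' hs hc.continuousOn (fun x hx ↦ hd x hx.2)
    hi.intervalIntegrable

theorem integral_Ioi_of_hasDerivAt_off_countable {F F' : ℝ → ℂ} {s : Set ℝ} (hs : s.Countable)
    (hc : Continuous F) (hd : ∀ x ∉ s, HasDerivAt F (F' x) x) (hi : Integrable F')
    (hF : HasCompactSupport F) (y : ℝ) : ∫ x in Ioi y, F' x = -F y := by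
  have h1 := intervalIntegral_tendsto_integral_Ioi (μ := volume) y hi.integrableOn tendsto_id
  have h2 : Tendsto (fun R ↦ F R - F y) atTop (𝓝 (0 - F y)) :=
    (hF.is_zero_at_infty.mono_left atTop_le_cocompact).sub_const _
  rw [zero_sub] at h2
  refine tendsto_nhds_unique (h1.congr fun R ↦ ?_) h2
  exact integral_eq_of_hasDerivAt_off_countable F F' hs hc.continuousOn (fun x hx ↦ hd x hx.2)
    hi.intervalIntegrable

theorem integral_ite_mul_deriv {f f' g g' φ : ℝ → ℂ} {s : Set ℝ} (hs : s.Countable)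
    (hf : Continuous f) (hg : Continuous g) (hf' : LocallyIntegrable f' volume)
    (hg' : LocallyIntegrable g' volume) (hfd : ∀ x ∉ s, HasDerivAt f (f' x) x)
    (hgd : ∀ x ∉ s, HasDerivAt g (g' x) x) (hφ : ContDiff ℝ ∞ φ) (hφc : HasCompactSupport φ)
    (y : ℝ) :
    ∫ x, (if x ≤ y then f x else g x) * deriv φ x =
      (f y - g y) * φ y - ∫ x, (if x ≤ y then f' x else g' x) * φ x := by
  have hφd : Continuous (deriv φ) := hφ.continuous_deriv (by norm_num)
  have hder : ∀ x, HasDerivAt φ (deriv φ x) x := fun x ↦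
    (hφ.differentiable (by norm_num) x).hasDerivAt
  have hint : ∀ {p p' : ℝ → ℂ}, Continuous p → LocallyIntegrable p' volume →
      Integrable (fun x ↦ p x * deriv φ x) ∧ Integrable (fun x ↦ p' x * φ x) := by
    intro p p' hp hp'
    refine ⟨(hp.mul hφd).integrable_of_hasCompactSupport hφc.deriv.mul_left, ?_⟩
    simpa only [smul_eq_mul] using
      hp'.integrable_smul_right_of_hasCompactSupport hφ.continuous hφc
  obtain ⟨hfφ', hf'φ⟩ := hint hf hf'
  obtain ⟨hgφ', hg'φ⟩ := hint hg hg'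
  have hsplit : ∀ {p q : ℝ → ℂ}, Integrable p → Integrable q →
      ∫ x, (if x ≤ y then p x else q x) = (∫ x in Iic y, p x) + ∫ x in Ioi y, q x := by
    intro p q hp hq
    have h := integral_piecewise (measurableSet_Iic (a := y)) hp.integrableOn
      (hq.integrableOn (s := (Iic y)ᶜ))
    rw [compl_Iic] at h
    rw [← h]
    congr 1
  simp only [ite_mul]
  rw [hsplit hfφ' hgφ', hsplit hf'φ hg'φ]
  have h1 := integral_Iic_of_hasDerivAt_off_countable hs (hf.mul hφ.continuous)
    (fun x hx ↦ (hfd x hx).mul (hder x)) (hf'φ.add hfφ') hφc.mul_left y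
  have h2 := integral_Ioi_of_hasDerivAt_off_countable hs (hg.mul hφ.continuous)
    (fun x hx ↦ (hgd x hx).mul (hder x)) (hg'φ.add hgφ') hφc.mul_left y
  rw [integral_add hf'φ.integrableOn hfφ'.integrableOn] at h1
  rw [integral_add hg'φ.integrableOn hgφ'.integrableOn] at h2
  simp only [Pi.mul_apply] at h1 h2
  linear_combination h1 + h2

theorem locallyIntegrable_L2R (w : L2R) : LocallyIntegrable w volume :=
  (Lp.memLp w).locallyIntegrable (by norm_num)

theorem continuous_primitive_L2R (w : L2R) : Continuous fun x ↦ ∫ t in (0 : ℝ)..x, w t :=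
  intervalIntegral.continuous_primitive (fun _ _ ↦ ((locallyIntegrable_L2R w).integrableOn_isCompact
    isCompact_uIcc).intervalIntegrable) 0

theorem integrable_L2R_mul (v : L2R) {φ : ℝ → ℂ} (hφ : Continuous φ)
    (hφc : HasCompactSupport φ) : Integrable fun x ↦ v x * φ x := by
  simpa only [smul_eq_mul] using
    (locallyIntegrable_L2R v).integrable_smul_right_of_hasCompactSupport hφ hφc

theorem integral_sub_L2R_mul (v v' : L2R) {φ : ℝ → ℂ} (hφ : Continuous φ)
    (hφc : HasCompactSupport φ) :
    ∫ x, (v - v') x * φ x = (∫ x, v x * φ x) - ∫ x, v' x * φ x := by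
  rw [← integral_sub (integrable_L2R_mul v hφ hφc) (integrable_L2R_mul v' hφ hφc)]
  refine integral_congr_ae ?_
  filter_upwards [Lp.coeFn_sub v v'] with x hx
  rw [hx, Pi.sub_apply, sub_mul]

theorem integral_smul_L2R_mul (c : ℂ) (v : L2R) (φ : ℝ → ℂ) :
    ∫ x, (c • v) x * φ x = c * ∫ x, v x * φ x := by
  rw [← integral_const_mul]
  refine integral_congr_ae ?_
  filter_upwards [Lp.coeFn_smul c v] with x hx
  rw [hx, Pi.smul_apply, smul_eq_mul, mul_assoc]

namespace HasWeakDeriv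

theorem exists_ae_eq_primitive {u w : L2R} (h : HasWeakDeriv u w) :
    ∃ c : ℂ, ∀ᵐ x : ℝ, u x = c + ∫ t in (0 : ℝ)..x, w t := by
  have hu := locallyIntegrable_L2R u
  have hW := continuous_primitive_L2R w
  obtain ⟨c, hc⟩ := ae_eq_const_of_integral_mul_deriv_eq_zero
    (h := fun x ↦ u x - ∫ t in (0 : ℝ)..x, w t) (hu.sub hW.locallyIntegrable) fun φ hφ hφc ↦ by
      have hφd : Continuous (deriv φ) := hφ.continuous_deriv (by norm_num)
      simp only [sub_mul]
      rw [integral_sub, h φ hφ hφc, integral_primitive_mul_deriv (locallyIntegrable_L2R w)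
        (hφ.of_le (by exact_mod_cast le_top)) hφc, sub_self]
      · exact integrable_L2R_mul u hφd hφc.deriv
      · exact (hW.mul hφd).integrable_of_hasCompactSupport hφc.deriv.mul_left
  refine ⟨c, hc.mono fun x hx ↦ ?_⟩
  linear_combination hx

theorem exists_continuous_ae_eq {u w : L2R} (h : HasWeakDeriv u w) :
    ∃ U : ℝ → ℂ, Continuous U ∧ (∀ᵐ x, u x = U x) ∧
      ∀ p : ℝ → ℂ, LocallyIntegrable p volume → (∀ᵐ x, w x = p x) →
        ∀ x, ContinuousAt p x → HasDerivAt U (p x) x := by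
  obtain ⟨c, hc⟩ := h.exists_ae_eq_primitive
  refine ⟨_, continuous_const.add (continuous_primitive_L2R w), hc, fun p hp hwp x hx ↦ ?_⟩
  have hprim (y : ℝ) : ∫ t in (0 : ℝ)..y, w t = ∫ t in (0 : ℝ)..y, p t :=
    intervalIntegral.integral_congr_ae (hwp.mono fun t ht _ ↦ ht)
  simp only [hprim]
  exact (intervalIntegral.integral_hasDerivAt_right
    (hp.integrableOn_isCompact isCompact_uIcc).intervalIntegrable
    hp.aestronglyMeasurable.stronglyMeasurableAtFilter hx).const_add c

theorem sub {u w u' w' : L2R} (h : HasWeakDeriv u w) (h' : HasWeakDeriv u' w') :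
    HasWeakDeriv (u - u') (w - w') := by
  intro φ hφ hφc
  rw [integral_sub_L2R_mul u u' (hφ.continuous_deriv (by norm_num)) hφc.deriv,
    integral_sub_L2R_mul w w' hφ.continuous hφc, h φ hφ hφc, h' φ hφ hφc]
  ring

theorem const_smul {u w : L2R} (h : HasWeakDeriv u w) (c : ℂ) :
    HasWeakDeriv (c • u) (c • w) := by
  intro φ hφ hφc
  rw [integral_smul_L2R_mul, integral_smul_L2R_mul, h φ hφ hφc, mul_neg]

end HasWeakDeriv

theorem OperatorGraph.sub {a : ℝ → ℝ} {u f u' f' : L2R} (h : OperatorGraph a u f)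
    (h' : OperatorGraph a u' f') : OperatorGraph a (u - u') (f - f') := by
  obtain ⟨w, q, hu, hq, hf⟩ := h
  obtain ⟨w', q', hu', hq', hf'⟩ := h'
  refine ⟨w - w', q - q', hu.sub hu', ?_, ?_⟩
  · filter_upwards [hq, hq', Lp.coeFn_sub w w', Lp.coeFn_sub q q'] with x e1 e2 e3 e4
    rw [e3, e4, Pi.sub_apply, Pi.sub_apply, e1, e2, mul_sub]
  · rw [neg_sub']
    exact hf.sub hf'

theorem operatorGraph_congr {a a' : ℝ → ℝ} (h : a =ᵐ[volume] a') :
    OperatorGraph a = OperatorGraph a' := by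
  ext u f
  refine exists₂_congr fun w q ↦ and_congr_right fun _ ↦ and_congr_left fun _ ↦
    eventually_congr ?_
  filter_upwards [h] with x hx
  rw [hx]

/-! ### Green kernels -/

/-- The kernel `f(x) r(y)` for `x ≤ y` and `g(x) l(y)` for `y < x`, the general form of the Green
kernel of a second order equation and of its derivatives in `x`. -/
def splitKernel (f g l r : ℝ → ℂ) (x y : ℝ) : ℂ :=
  if x ≤ y then f x * r y else g x * l y

section

variable {f g f' g' l r : ℝ → ℂ}

theorem mul_splitKernel (p f g l r : ℝ → ℂ) (x y : ℝ) :
    p x * splitKernel f g l r x y =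
      splitKernel (fun x ↦ p x * f x) (fun x ↦ p x * g x) l r x y := by
  simp only [splitKernel, mul_ite, mul_assoc]

theorem measurable_splitKernel (hf : Measurable f) (hg : Measurable g) (hl : Measurable l)
    (hr : Measurable r) : Measurable (Function.uncurry (splitKernel f g l r)) :=
  Measurable.ite (measurableSet_le measurable_fst measurable_snd)
    ((hf.comp measurable_fst).mul (hr.comp measurable_snd))
    ((hg.comp measurable_fst).mul (hl.comp measurable_snd))

theorem integrable_exp_neg_mul_abs {η : ℝ} (hη : 0 < η) :
    Integrable fun t : ℝ ↦ Real.exp (-(η * |t|)) := by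
  have hIoi : IntegrableOn (fun t : ℝ ↦ Real.exp (-(η * |t|))) (Ioi 0) :=
    (integrableOn_exp_mul_Ioi (neg_lt_zero.2 hη) 0).congr_fun
      (fun t ht ↦ by simp [abs_of_pos (mem_Ioi.1 ht)]) measurableSet_Ioi
  have hIic : IntegrableOn (fun t : ℝ ↦ Real.exp (-(η * |t|))) (Iic 0) :=
    (integrableOn_exp_mul_Iic hη 0).congr_fun
      (fun t ht ↦ by simp [abs_of_nonpos (mem_Iic.1 ht)]) measurableSet_Iic
  rw [← integrableOn_univ, ← Iic_union_Ioi (a := (0 : ℝ))]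
  exact hIic.union hIoi

theorem exists_norm_splitKernel_le {η : ℝ} (hf : f =O[⊤] fun x ↦ Real.exp (η * x))
    (hg : g =O[⊤] fun x ↦ Real.exp (-(η * x))) (hl : l =O[⊤] fun x ↦ Real.exp (η * x))
    (hr : r =O[⊤] fun x ↦ Real.exp (-(η * x))) :
    ∃ C, ∀ x y, ‖splitKernel f g l r x y‖ ≤ C * Real.exp (-(η * |x - y|)) := by
  simp only [Asymptotics.isBigO_top, Real.norm_eq_abs, Real.abs_exp] at hf hg hl hr
  obtain ⟨F, hF⟩ := hf
  obtain ⟨G, hG⟩ := hg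
  obtain ⟨L, hL⟩ := hl
  obtain ⟨R, hR⟩ := hr
  refine ⟨max (F * R) (G * L), fun x y ↦ ?_⟩
  rw [splitKernel]
  split_ifs with h
  · rw [abs_of_nonpos (by linarith)]
    calc ‖f x * r y‖ ≤ F * Real.exp (η * x) * (R * Real.exp (-(η * y))) :=
          norm_mul_le_of_le (hF x) (hR y)
      _ = F * R * Real.exp (-(η * -(x - y))) := by
          rw [mul_mul_mul_comm, ← Real.exp_add]
          ring_nf
      _ ≤ _ := by
          gcongr
          exact le_max_left _ _
  · rw [abs_of_nonneg (by linarith)]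
    calc ‖g x * l y‖ ≤ G * Real.exp (-(η * x)) * (L * Real.exp (η * y)) :=
          norm_mul_le_of_le (hG x) (hL y)
      _ = G * L * Real.exp (-(η * (x - y))) := by
          rw [mul_mul_mul_comm, ← Real.exp_add]
          ring_nf
      _ ≤ _ := by
          gcongr
          exact le_max_right _ _

theorem exists_isSchurKernel_splitKernel {η : ℝ} (hη : 0 < η) (hfm : Measurable f)
    (hgm : Measurable g) (hlm : Measurable l) (hrm : Measurable r)
    (hf : f =O[⊤] fun x ↦ Real.exp (η * x)) (hg : g =O[⊤] fun x ↦ Real.exp (-(η * x)))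
    (hl : l =O[⊤] fun x ↦ Real.exp (η * x)) (hr : r =O[⊤] fun x ↦ Real.exp (-(η * x))) :
    ∃ A, IsSchurKernel volume volume (splitKernel f g l r) A := by
  obtain ⟨C, hC⟩ := exists_norm_splitKernel_le hf hg hl hr
  set k : ℝ → ℝ≥0∞ := fun t ↦ ENNReal.ofReal (C * Real.exp (-(η * |t|)))
  have hk (x y : ℝ) : ‖splitKernel f g l r x y‖ₑ ≤ k (x - y) := by
    rw [← ofReal_norm]
    exact ENNReal.ofReal_le_ofReal (hC x y)
  have hfin : ∫⁻ t, k t ≠ ⊤ := ((integrable_exp_neg_mul_abs hη).const_mul C).lintegral_lt_top.ne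
  refine ⟨(∫⁻ t, k t).toNNReal, measurable_splitKernel hfm hgm hlm hrm, fun x ↦ ?_, fun y ↦ ?_⟩ <;>
    rw [ENNReal.coe_toNNReal hfin]
  · exact (lintegral_mono (hk x)).trans_eq (lintegral_sub_left_eq_self k x)
  · exact (lintegral_mono fun x ↦ hk x y).trans_eq (lintegral_sub_right_eq_self k y)

theorem hasWeakDeriv_of_splitKernel {A A' : ℝ≥0} {L L' : L2R →L[ℂ] L2R}
    (hK : IsSchurKernel volume volume (splitKernel f g l r) A)
    (hK' : IsSchurKernel volume volume (splitKernel f' g' l r) A')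
    (hL : HasKernel L (splitKernel f g l r)) (hL' : HasKernel L' (splitKernel f' g' l r))
    {s : Set ℝ} (hs : s.Countable) (hf : Continuous f) (hg : Continuous g)
    (hf' : LocallyIntegrable f' volume) (hg' : LocallyIntegrable g' volume)
    (hfd : ∀ x ∉ s, HasDerivAt f (f' x) x) (hgd : ∀ x ∉ s, HasDerivAt g (g' x) x) {j : ℂ}
    (hj : ∀ y, f y * r y - g y * l y = j) (v : L2R) : HasWeakDeriv (L v) (L' v - j • v) := by
  intro φ hφ hφc
  have hφd : Continuous (deriv φ) := hφ.continuous_deriv (by norm_num)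
  have hφ2 : MemLp φ 2 volume := hφ.continuous.memLp_of_hasCompactSupport hφc
  have hφd2 : MemLp (deriv φ) 2 volume := hφd.memLp_of_hasCompactSupport hφc.deriv
  have hvφ : Integrable fun y ↦ j * (v y * φ y) :=
    (integrable_L2R_mul v hφ.continuous hφc).const_mul j
  have hint : Integrable fun y ↦ (∫ x, splitKernel f' g' l r x y * φ x) * v y := by
    refine (hK'.integrable_prod v hφ.continuous.measurable hφ2).integral_prod_right.congr
      (.of_forall fun y ↦ ?_)
    simp only [← integral_mul_const, mul_left_comm (φ _), mul_comm (φ _), mul_assoc]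
  have hmul {p : ℝ → ℂ} (c : ℂ) (hp : LocallyIntegrable p volume) :
      LocallyIntegrable (fun x ↦ p x * c) volume := by
    simpa [Pi.smul_def, mul_comm] using hp.smul c
  have hdiag (y : ℝ) : ∫ x, splitKernel f g l r x y * deriv φ x =
      j * φ y - ∫ x, splitKernel f' g' l r x y * φ x := by
    rw [← hj y]
    exact integral_ite_mul_deriv hs (hf.mul continuous_const) (hg.mul continuous_const)
      (hmul (r y) hf') (hmul (l y) hg') (fun x hx ↦ (hfd x hx).mul_const (r y))
      (fun x hx ↦ (hgd x hx).mul_const (l y)) hφ hφc y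
  calc ∫ x, L v x * deriv φ x
      = ∫ y, (j * (v y * φ y) - (∫ x, splitKernel f' g' l r x y * φ x) * v y) := by
        rw [hK.integral_apply_mul hL v hφd.measurable hφd2]
        refine integral_congr_ae (.of_forall fun y ↦ ?_)
        simp only [hdiag]
        ring
    _ = j * (∫ y, v y * φ y) - ∫ x, L' v x * φ x := by
        rw [integral_sub hvφ hint, integral_const_mul,
          hK'.integral_apply_mul hL' v hφ.continuous.measurable hφ2]
    _ = -∫ x, (L' v - j • v) x * φ x := by
        rw [integral_sub_L2R_mul _ _ hφ.continuous hφc, integral_smul_L2R_mul, neg_sub]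

end

/-! ### The resolvent from two decaying solutions -/

/-- The coefficients `a` of the operators `-∂ₓ a ∂ₓ` considered here: `a⁻¹` is bounded, and `a` is
continuous off a countable set `s` of interfaces. -/
structure IsRegularCoeff (a : ℝ → ℝ) (s : Set ℝ) : Prop where
  countable : s.Countable
  measurable : Measurable a
  ne_zero : ∀ x, a x ≠ 0
  exists_bound : ∃ B, ∀ x, ‖(a x : ℂ)⁻¹‖ ≤ B
  continuousAt : ∀ x ∉ s, ContinuousAt a x

/-- `Z = (u, v)` solves `-(a u')' = lam² u`, written as the first order system `u' = i lam a⁻¹ v`,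
`v' = i lam u` with `v = a u' / (i lam)`. Continuity of `Z` across the points of `s` is the
transmission condition. -/
structure IsSolution (a : ℝ → ℝ) (s : Set ℝ) (lam : ℂ) (Z : ℝ → ℂ × ℂ) : Prop where
  continuous : Continuous Z
  hasDerivAt_fst : ∀ x ∉ s,
    HasDerivAt (fun y ↦ (Z y).1) (I * lam * ((a x : ℂ)⁻¹ * (Z x).2)) x
  hasDerivAt_snd : ∀ x ∉ s, HasDerivAt (fun y ↦ (Z y).2) (I * lam * (Z x).1) x

/-- The Wronskian of two states. -/
def wronskian (w z : ℂ × ℂ) : ℂ := w.1 * z.2 - z.1 * w.2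

theorem norm_wronskian_le (w z : ℂ × ℂ) : ‖wronskian w z‖ ≤ 2 * ‖z‖ * ‖w‖ := by
  calc ‖wronskian w z‖ ≤ ‖w‖ * ‖z‖ + ‖z‖ * ‖w‖ :=
        (norm_sub_le _ _).trans (add_le_add
          (norm_mul_le_of_le (norm_fst_le w) (norm_snd_le z))
          (norm_mul_le_of_le (norm_fst_le z) (norm_snd_le w)))
    _ = 2 * ‖z‖ * ‖w‖ := by ring

theorem fst_eq_zero_of_wronskian_eq_zero {w l r : ℂ × ℂ} (hl : wronskian w l = 0)
    (hr : wronskian w r = 0) (hlr : wronskian l r ≠ 0) : w.1 = 0 := by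
  refine (mul_eq_zero.1 ?_).resolve_left hlr
  rw [wronskian] at *
  linear_combination l.1 * hr - r.1 * hl

section

variable {a : ℝ → ℝ} {s : Set ℝ} {lam : ℂ} {Z l r : ℝ → ℂ × ℂ} {u : L2R}

namespace IsRegularCoeff

theorem measurable_inv (ha : IsRegularCoeff a s) : Measurable fun x ↦ (a x : ℂ)⁻¹ :=
  (Complex.measurable_ofReal.comp ha.measurable).inv

theorem isBigO_inv (ha : IsRegularCoeff a s) : (fun x ↦ (a x : ℂ)⁻¹) =O[⊤] fun _ ↦ (1 : ℝ) := by
  rw [Asymptotics.isBigO_top]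
  simpa only [norm_one, mul_one] using ha.exists_bound

theorem locallyIntegrable_inv_mul (ha : IsRegularCoeff a s) {g : ℝ → ℂ} (hg : Continuous g) :
    LocallyIntegrable (fun x ↦ (a x : ℂ)⁻¹ * g x) volume := by
  obtain ⟨B, hB⟩ := ha.exists_bound
  have hBg : Continuous fun x ↦ (B : ℂ) * g x := by fun_prop
  refine hBg.locallyIntegrable.mono (ha.measurable_inv.mul hg.measurable).aestronglyMeasurable
    (.of_forall fun x ↦ ?_)
  rw [norm_mul, norm_mul, Complex.norm_real]
  gcongr
  exact (hB x).trans (le_abs_self B)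

end IsRegularCoeff

theorem eq_of_hasDerivAt_zero_off_countable {F : ℝ → ℂ} (hs : s.Countable) (hc : Continuous F)
    (hd : ∀ x ∉ s, HasDerivAt F 0 x) (x y : ℝ) : F x = F y := by
  have h := integral_eq_of_hasDerivAt_off_countable F (fun _ ↦ 0) (a := y) (b := x) hs
    hc.continuousOn (fun z hz ↦ hd z hz.2) (by simp)
  rw [intervalIntegral.integral_zero] at h
  exact sub_eq_zero.1 h.symm

theorem IsSolution.wronskian_eq (hs : s.Countable) (hl : IsSolution a s lam l)
    (hr : IsSolution a s lam r) (x y : ℝ) : wronskian (l x) (r x) = wronskian (l y) (r y) := by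
  have hlc := hl.continuous
  have hrc := hr.continuous
  refine eq_of_hasDerivAt_zero_off_countable (F := fun x ↦ wronskian (l x) (r x)) hs
    (by unfold wronskian; fun_prop) (fun x hx ↦ ?_) x y
  refine (((hl.hasDerivAt_fst x hx).mul (hr.hasDerivAt_snd x hx)).sub
    ((hr.hasDerivAt_fst x hx).mul (hl.hasDerivAt_snd x hx))).congr_deriv ?_
  ring

theorem OperatorGraph.exists_isSolution (ha : IsRegularCoeff a s) (hlam : lam ≠ 0)
    (h : OperatorGraph a u (lam ^ 2 • u)) :
    ∃ Z, IsSolution a s lam Z ∧ MemLp Z 2 volume ∧ ∀ᵐ x, u x = (Z x).1 := by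
  obtain ⟨w, q, huw, hqw, hqu⟩ := h
  obtain ⟨U, hUc, huU, hU⟩ := huw.exists_continuous_ae_eq
  obtain ⟨Q, hQc, hqQ, hQ⟩ := hqu.exists_continuous_ae_eq
  have hw : ∀ᵐ x, w x = (a x : ℂ)⁻¹ * Q x := by
    filter_upwards [hqw, hqQ] with x e1 e2
    rw [← e2, e1, inv_mul_cancel_left₀ (Complex.ofReal_ne_zero.2 (ha.ne_zero x))]
  have hu : ∀ᵐ x, (-(lam ^ 2 • u) : L2R) x = -(lam ^ 2 * U x) := by
    filter_upwards [huU, Lp.coeFn_neg (lam ^ 2 • u), Lp.coeFn_smul (lam ^ 2) u] with x e1 e2 e3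
    rw [e2, Pi.neg_apply, e3, Pi.smul_apply, e1, smul_eq_mul]
  have hUd (x : ℝ) (hx : x ∉ s) : HasDerivAt U ((a x : ℂ)⁻¹ * Q x) x :=
    hU _ (ha.locallyIntegrable_inv_mul hQc) hw x
      (((Complex.continuous_ofReal.continuousAt.comp (ha.continuousAt x hx)).inv₀
        (Complex.ofReal_ne_zero.2 (ha.ne_zero x))).mul hQc.continuousAt)
  have hlamU : Continuous fun x ↦ -(lam ^ 2 * U x) := by fun_prop
  have hQd (x : ℝ) : HasDerivAt Q (-(lam ^ 2 * U x)) x :=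
    hQ _ hlamU.locallyIntegrable hu x hlamU.continuousAt
  refine ⟨fun x ↦ (U x, (I * lam)⁻¹ * Q x), ⟨by fun_prop, fun x hx ↦ ?_, fun x _ ↦ ?_⟩,
    MemLp.of_fst_snd ⟨(memLp_congr_ae huU).1 (Lp.memLp u),
      ((memLp_congr_ae hqQ).1 (Lp.memLp q)).const_mul _⟩, huU⟩
  · refine (hUd x hx).congr_deriv ?_
    field_simp
  · refine ((hQd x).const_mul (I * lam)⁻¹).congr_deriv ?_
    field_simp
    rw [Complex.I_sq]
    ring

theorem IsSolution.wronskian_eq_zero_of_memLp (hs : s.Countable) (hZ : IsSolution a s lam Z)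
    (hZ2 : MemLp Z 2 volume) (hl : IsSolution a s lam l) {S : Set ℝ} (hSm : MeasurableSet S)
    (hS : volume S = ⊤) {C : ℝ} (hC : ∀ x ∈ S, ‖l x‖ ≤ C) (x : ℝ) :
    wronskian (Z x) (l x) = 0 := by
  have hconst : MemLp (fun _ ↦ wronskian (Z x) (l x)) 2 (volume.restrict S) := by
    refine (hZ2.restrict S).of_le_mul (c := 2 * C) aestronglyMeasurable_const ?_
    filter_upwards [ae_restrict_mem hSm] with y hy
    rw [hZ.wronskian_eq hs hl x y]
    refine (norm_wronskian_le _ _).trans ?_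
    gcongr
    exact hC y hy
  rw [memLp_const_iff (by norm_num) (by norm_num), Measure.restrict_apply_univ] at hconst
  exact hconst.resolve_right hS.not_lt

/-- A pair of solutions, the first decaying exponentially at `-∞` and the second at `+∞`. -/
structure IsDecayingPair (a : ℝ → ℝ) (s : Set ℝ) (lam : ℂ) (η : ℝ) (l r : ℝ → ℂ × ℂ) : Prop where
  pos : 0 < η
  left : IsSolution a s lam l
  right : IsSolution a s lam r
  isBigO_left : l =O[⊤] fun x ↦ Real.exp (η * x)
  isBigO_right : r =O[⊤] fun x ↦ Real.exp (-(η * x))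

/-- The kernel `u₋(min(x, y)) u₊(max(x, y))` built from the first components of two solutions. -/
def greenKernel (l r : ℝ → ℂ × ℂ) : ℝ → ℝ → ℂ :=
  splitKernel (fun x ↦ (l x).1) (fun x ↦ (r x).1) (fun x ↦ (l x).1) (fun x ↦ (r x).1)

namespace IsDecayingPair

variable {η : ℝ}

theorem eq_zero_of_operatorGraph (h : IsDecayingPair a s lam η l r) (ha : IsRegularCoeff a s)
    (hlam : lam ≠ 0) (hD : wronskian (l 0) (r 0) ≠ 0) (hu : OperatorGraph a u (lam ^ 2 • u)) :
    u = 0 := by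
  obtain ⟨Z, hZ, hZ2, huZ⟩ := hu.exists_isSolution ha hlam
  obtain ⟨L, hL0, hL⟩ := h.isBigO_left.exists_nonneg
  obtain ⟨R, hR0, hR⟩ := h.isBigO_right.exists_nonneg
  rw [Asymptotics.isBigOWith_top] at hL hR
  have hZl (x : ℝ) : wronskian (Z x) (l x) = 0 := by
    refine hZ.wronskian_eq_zero_of_memLp ha.countable hZ2 h.left (measurableSet_Iic (a := 0))
      (by simp) (C := L) (fun y hy ↦ (hL y).trans (mul_le_of_le_one_right hL0 ?_)) x
    rw [Real.norm_eq_abs, Real.abs_exp, Real.exp_le_one_iff]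
    exact mul_nonpos_of_nonneg_of_nonpos h.pos.le hy
  have hZr (x : ℝ) : wronskian (Z x) (r x) = 0 := by
    refine hZ.wronskian_eq_zero_of_memLp ha.countable hZ2 h.right (measurableSet_Ici (a := 0))
      (by simp) (C := R) (fun y hy ↦ (hR y).trans (mul_le_of_le_one_right hR0 ?_)) x
    rw [Real.norm_eq_abs, Real.abs_exp, Real.exp_le_one_iff]
    exact neg_nonpos.2 (mul_nonneg h.pos.le hy)
  refine Lp.ext ?_
  filter_upwards [huZ, Lp.coeFn_zero ℂ 2 volume] with x hx h0
  rw [hx, h0, Pi.zero_apply]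
  refine fst_eq_zero_of_wronskian_eq_zero (hZl x) (hZr x) ?_
  rwa [h.left.wronskian_eq ha.countable h.right x 0]

theorem exists_hasKernel (h : IsDecayingPair a s lam η l r) {f g : ℝ → ℂ} (hfm : Measurable f)
    (hgm : Measurable g) (hf : f =O[⊤] fun x ↦ Real.exp (η * x))
    (hg : g =O[⊤] fun x ↦ Real.exp (-(η * x))) :
    ∃ A L, IsSchurKernel volume volume
        (splitKernel f g (fun x ↦ (l x).1) (fun x ↦ (r x).1)) A ∧
      HasKernel (μ := volume) (ν := volume) L
        (splitKernel f g (fun x ↦ (l x).1) (fun x ↦ (r x).1)) := by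
  obtain ⟨A, hA⟩ := exists_isSchurKernel_splitKernel h.pos hfm hgm
    h.left.continuous.fst.measurable h.right.continuous.fst.measurable hf hg
    (Asymptotics.isBigO_fst_prod'.trans h.isBigO_left)
    (Asymptotics.isBigO_fst_prod'.trans h.isBigO_right)
  obtain ⟨L, hL⟩ := hA.exists_hasKernel
  exact ⟨A, L, hA, hL⟩

theorem exists_hasWeakDeriv (h : IsDecayingPair a s lam η l r) (ha : IsRegularCoeff a s)
    {A : ℝ≥0} {G : L2R →L[ℂ] L2R} (hA : IsSchurKernel volume volume (greenKernel l r) A)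
    (hG : HasKernel G (greenKernel l r)) (f : L2R) :
    ∃ v w, HasWeakDeriv (G f) w ∧ (∀ᵐ x, w x = I * lam * ((a x : ℂ)⁻¹ * v x)) ∧
      HasWeakDeriv v ((I * lam) • G f + wronskian (l 0) (r 0) • f) := by
  obtain ⟨hl, hr⟩ := And.intro h.left h.right
  have hsnd {Z : ℝ → ℂ × ℂ} {e : ℝ → ℝ} (hZ : Z =O[⊤] e) :
      (fun x ↦ I * lam * ((a x : ℂ)⁻¹ * (Z x).2)) =O[⊤] e := by
    simpa using (ha.isBigO_inv.mul (Asymptotics.isBigO_snd_prod'.trans hZ)).const_mul_left (I * lam)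
  obtain ⟨AV, V, hAV, hV⟩ := h.exists_hasKernel hl.continuous.snd.measurable
    hr.continuous.snd.measurable (Asymptotics.isBigO_snd_prod'.trans h.isBigO_left)
    (Asymptotics.isBigO_snd_prod'.trans h.isBigO_right)
  obtain ⟨AW, W, hAW, hW⟩ := h.exists_hasKernel
    ((ha.measurable_inv.fun_mul hl.continuous.snd.measurable).const_mul _)
    ((ha.measurable_inv.fun_mul hr.continuous.snd.measurable).const_mul _)
    (hsnd h.isBigO_left) (hsnd h.isBigO_right)
  refine ⟨V f, W f, ?_, ?_, ?_⟩
  · simpa using hasWeakDeriv_of_splitKernel hA hAW hG hW ha.countable hl.continuous.fst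
      hr.continuous.fst ((ha.locallyIntegrable_inv_mul hl.continuous.snd).smul (I * lam))
      ((ha.locallyIntegrable_inv_mul hr.continuous.snd).smul (I * lam)) hl.hasDerivAt_fst
      hr.hasDerivAt_fst (fun y ↦ sub_eq_zero.2 (mul_comm _ _)) f
  · filter_upwards [hV f, hW f] with x hVx hWx
    rw [hVx, hWx, ← integral_const_mul, ← integral_const_mul]
    congr with y
    rw [← mul_assoc (a x : ℂ)⁻¹, ← mul_assoc (I * lam)]
    rw [mul_splitKernel (fun x ↦ (a x : ℂ)⁻¹), mul_splitKernel (fun _ ↦ I * lam)]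
  · have hA' := hA.const_mul (I * lam)
    have hG' := hG.const_smul (I * lam)
    simp only [greenKernel, mul_splitKernel (fun _ ↦ I * lam)] at hA' hG'
    have hVG := hasWeakDeriv_of_splitKernel (j := -wronskian (l 0) (r 0)) hAV hA' hV hG'
      ha.countable hl.continuous.snd hr.continuous.snd
      (continuous_const.mul hl.continuous.fst).locallyIntegrable
      (continuous_const.mul hr.continuous.fst).locallyIntegrable hl.hasDerivAt_snd
      hr.hasDerivAt_snd (fun y ↦ by rw [hl.wronskian_eq ha.countable hr 0 y, wronskian]; ring) f
    rwa [neg_smul, sub_neg_eq_add] at hVG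

theorem operatorGraph_of_hasKernel (h : IsDecayingPair a s lam η l r) (ha : IsRegularCoeff a s)
    (hlam : lam ≠ 0) (hD : wronskian (l 0) (r 0) ≠ 0) {A : ℝ≥0} {G : L2R →L[ℂ] L2R}
    (hA : IsSchurKernel volume volume (greenKernel l r) A) (hG : HasKernel G (greenKernel l r))
    (f : L2R) : OperatorGraph a ((I / (lam * wronskian (l 0) (r 0))) • G f)
      (lam ^ 2 • (I / (lam * wronskian (l 0) (r 0))) • G f + f) := by
  obtain ⟨v, w, hGw, hwv, hv⟩ := h.exists_hasWeakDeriv ha hA hG f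
  set D := wronskian (l 0) (r 0)
  set c := I / (lam * D) with hc
  refine ⟨c • w, (I * lam * c) • v, hGw.const_smul c, ?_, ?_⟩
  · filter_upwards [Lp.coeFn_smul c w, Lp.coeFn_smul (I * lam * c) v, hwv] with x e1 e2 e3
    have hax : (a x : ℂ) ≠ 0 := Complex.ofReal_ne_zero.2 (ha.ne_zero x)
    rw [e1, e2, Pi.smul_apply, Pi.smul_apply, e3, smul_eq_mul, smul_eq_mul]
    field_simp
  · have hsq : I * lam * c * (I * lam) = -(lam ^ 2 * c) := by
      linear_combination lam ^ 2 * c * Complex.I_sq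
    have hcD : I * lam * c * D = -1 := by
      rw [hc]
      field_simp
      exact Complex.I_sq
    convert hv.const_smul (I * lam * c) using 1
    rw [smul_add, smul_smul, smul_smul, smul_smul, hsq, hcD, neg_smul, neg_one_smul, neg_add]

theorem exists_isResolventAt (h : IsDecayingPair a s lam η l r) (ha : IsRegularCoeff a s)
    (hlam : lam ≠ 0) (hD : wronskian (l 0) (r 0) ≠ 0) :
    ∃ G : L2R →L[ℂ] L2R, HasKernel G (greenKernel l r) ∧
      IsResolventAt a lam ((I / (lam * wronskian (l 0) (r 0))) • G) := by
  obtain ⟨A, G, hA, hG⟩ := h.exists_hasKernel h.left.continuous.fst.measurable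
    h.right.continuous.fst.measurable (Asymptotics.isBigO_fst_prod'.trans h.isBigO_left)
    (Asymptotics.isBigO_fst_prod'.trans h.isBigO_right)
  have hgraph := h.operatorGraph_of_hasKernel ha hlam hD hA hG
  refine ⟨G, hG, fun u v ↦ ⟨fun huv ↦ ?_, ?_⟩⟩
  · refine sub_eq_zero.1 (h.eq_zero_of_operatorGraph ha hlam hD ?_)
    have hsub := huv.sub (hgraph v)
    rwa [add_sub_add_right_eq_sub, ← smul_sub] at hsub
  · rintro rfl
    exact hgraph v

end IsDecayingPair

end

/-! ### Meromorphic continuation of the resolvent -/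

theorem isResolventAt_unique {a : ℝ → ℝ} {lam : ℂ} {R R' : L2R →L[ℂ] L2R}
    (h : IsResolventAt a lam R) (h' : IsResolventAt a lam R') : R = R' := by
  ext1 v
  exact (h' (R v) v).1 ((h (R v) v).2 rfl)

theorem meromorphicOrderAt_ne_top_of_meromorphic {E : Type*} [NormedAddCommGroup E]
    [NormedSpace ℂ E] {f : ℂ → E} (hf : Meromorphic f) {z : ℂ} (hz : meromorphicOrderAt f z ≠ ⊤)
    (w : ℂ) : meromorphicOrderAt f w ≠ ⊤ :=
  MeromorphicOn.meromorphicOrderAt_ne_top_of_isPreconnected (U := univ) (fun z _ ↦ hf z)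
    isPreconnected_univ (mem_univ z) (mem_univ w) hz

theorem IsContinuedResolvent.meromorphicOrderAt_eq {a : ℝ → ℝ} {N : ℕ}
    {T T' : ℂ → L2R →L[ℂ] L2R} (h : IsContinuedResolvent a N T)
    (h' : IsContinuedResolvent a N T') (lam : ℂ) :
    meromorphicOrderAt T lam = meromorphicOrderAt T' lam := by
  have heq (z : ℂ) (hz : 0 < z.im) : T z = T' z := by
    obtain ⟨R, hR, hT⟩ := h.2 z hz
    obtain ⟨R', hR', hT'⟩ := h'.2 z hz
    rw [hT, hT', isResolventAt_unique hR hR']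
  have hI : meromorphicOrderAt (T - T') I = ⊤ := by
    rw [meromorphicOrderAt_eq_top_iff]
    refine eventually_nhdsWithin_of_eventually_nhds ?_
    filter_upwards [(isOpen_lt continuous_const Complex.continuous_im).mem_nhds
      (show (0 : ℝ) < I.im by simp)] with z hz
    rw [Pi.sub_apply, heq z hz, sub_self]
  have hlam : meromorphicOrderAt (T - T') lam = ⊤ := by
    by_contra hne
    exact meromorphicOrderAt_ne_top_of_meromorphic (fun z ↦ (h.1 z).sub (h'.1 z)) hne I hI
  rw [meromorphicOrderAt_eq_top_iff] at hlam
  exact meromorphicOrderAt_congr (hlam.mono fun z hz ↦ sub_eq_zero.1 hz)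

theorem meromorphicOrderAt_div_smul_neg {E : Type*} [NormedAddCommGroup E] [NormedSpace ℂ E]
    {W : ℂ → ℂ} {S : ℂ → E} {c z : ℂ} (hW : AnalyticAt ℂ W z) (hS : AnalyticAt ℂ S z)
    (hWtop : meromorphicOrderAt W z ≠ ⊤) (hWz : W z = 0) (hSz : S z ≠ 0) (hc : c ≠ 0) :
    meromorphicOrderAt ((fun w ↦ c / W w) • S) z < 0 := by
  have hWne : ∀ᶠ w in 𝓝[≠] z, W w ≠ 0 := by
    rwa [← meromorphicOrderAt_ne_top_iff_eventually_ne_zero hW.meromorphicAt]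
  have hWlim : Tendsto W (𝓝[≠] z) (𝓝[≠] 0) := tendsto_nhdsWithin_iff.2
    ⟨hWz ▸ hW.continuousAt.tendsto.mono_left nhdsWithin_le_nhds, hWne⟩
  have hdiv : Tendsto (fun w ↦ ‖c / W w‖) (𝓝[≠] z) atTop := by
    simpa only [norm_mul, norm_inv, div_eq_mul_inv, Function.comp_def] using
      ((tendsto_norm_inv_nhdsNE_zero_atTop (α := ℂ)).comp hWlim).const_mul_atTop (norm_pos_iff.2 hc)
  have hSlim : Tendsto (fun w ↦ ‖S w‖) (𝓝[≠] z) (𝓝 ‖S z‖) :=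
    hS.continuousAt.norm.tendsto.mono_left nhdsWithin_le_nhds
  have hT : MeromorphicAt ((fun w ↦ c / W w) • S) z :=
    ((MeromorphicAt.const c z).div hW.meromorphicAt).smul hS.meromorphicAt
  rw [← tendsto_cobounded_iff_meromorphicOrderAt_neg hT, ← tendsto_norm_atTop_iff_cobounded]
  simpa only [Pi.smul_apply', norm_smul] using hdiv.atTop_mul_pos (norm_pos_iff.2 hSz) hSlim

/-- The restriction of a kernel to the square `[-N, N]²`. -/
def cutKernel (N : ℕ) (K : ℝ → ℝ → ℂ) (x y : ℝ) : ℂ :=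
  (Icc (-(N : ℝ)) N ×ˢ Icc (-(N : ℝ)) N).indicator (Function.uncurry K) (x, y)

theorem HasKernel.cutoff_comp {K : ℝ → ℝ → ℂ} {L : L2R →L[ℂ] L2R} (hL : HasKernel L K) (N : ℕ) :
    HasKernel (cutoff N ∘L L ∘L cutoff N) (cutKernel N K) := by
  intro f
  filter_upwards [cutoffFun_ae N (L (cutoff N f)), hL (cutoff N f)] with x h1 h2
  change cutoffFun N (L (cutoff N f)) x = _
  rw [h1]
  by_cases hx : x ∈ Icc (-(N : ℝ)) N
  · rw [indicator_of_mem hx, h2]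
    refine integral_congr_ae ?_
    filter_upwards [cutoffFun_ae N f] with y hy
    change K x y * cutoffFun N f y = _
    by_cases hy' : y ∈ Icc (-(N : ℝ)) N <;>
      simp only [hy, cutKernel, indicator_apply, mem_prod, hx, hy', and_true, and_false, if_true,
        if_false, mul_zero, zero_mul, Function.uncurry_apply_pair]
  · simp only [cutKernel, indicator_apply, mem_prod, hx, false_and, if_false, zero_mul,
      integral_zero]

theorem exists_integral_cutKernel_eq {l r : ℝ → ℂ × ℂ} (hr : Continuous r) {y₀ : ℝ}
    (hr₀ : (r y₀).1 ≠ 0) {N : ℕ} (hy₀ : y₀ + 1 ≤ N) :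
    ∃ (f : L2R) (m : ℂ), m ≠ 0 ∧ ∀ x ∈ Ioo (-(N : ℝ)) y₀,
      ∫ y, cutKernel N (greenKernel l r) x y * f y = (l x).1 * m := by
  let J : Set ℝ := Ioc y₀ (y₀ + 1)
  have hrc : Continuous fun y ↦ star (r y).1 := by fun_prop
  obtain ⟨B, hB⟩ := (isCompact_Icc (a := y₀) (b := y₀ + 1)).exists_bound_of_continuousOn
    hrc.continuousOn
  have hmem : MemLp (J.indicator fun y ↦ star (r y).1) 2 volume := by
    rw [memLp_indicator_iff_restrict measurableSet_Ioc]
    exact MemLp.of_bound hrc.aestronglyMeasurable B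
      ((ae_restrict_mem measurableSet_Ioc).mono fun y hy ↦ hB y (Ioc_subset_Icc_self hy))
  have hm : 0 < ∫ y in y₀..y₀ + 1, ‖(r y).1‖ ^ 2 := intervalIntegral.integral_pos (by linarith)
    (by fun_prop) (fun y _ ↦ by positivity) ⟨y₀, by simp, by positivity⟩
  refine ⟨hmem.toLp, _, Complex.ofReal_ne_zero.2 hm.ne', fun x hx ↦ ?_⟩
  rw [intervalIntegral.integral_of_le (by linarith), ← integral_complex_ofReal,
    ← integral_const_mul, ← integral_indicator measurableSet_Ioc]
  refine integral_congr_ae (hmem.coeFn_toLp.mono fun y hy ↦ ?_)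
  simp only [hy]
  by_cases hyJ : y ∈ J
  · have hxy : x ≤ y := hx.2.le.trans hyJ.1.le
    have hxyN : (x, y) ∈ Icc (-(N : ℝ)) N ×ˢ Icc (-(N : ℝ)) N := by
      simp only [mem_prod, mem_Icc]
      refine ⟨⟨?_, ?_⟩, ?_, ?_⟩ <;> linarith [hx.1, hyJ.1, hyJ.2]
    simp only [cutKernel, indicator_of_mem hxyN, indicator_of_mem hyJ, Function.uncurry_apply_pair,
      greenKernel, splitKernel, if_pos hxy, Complex.ofReal_pow]
    rw [indicator_of_mem hyJ, mul_assoc, ← Complex.mul_conj', starRingEnd_apply]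
  · simp only [J, indicator_of_notMem hyJ, mul_zero]

theorem ne_zero_of_hasKernel_cutKernel {l r : ℝ → ℂ × ℂ} (hl : Continuous l) (hr : Continuous r)
    {x₀ y₀ : ℝ} (hxy : x₀ < y₀) (hl₀ : (l x₀).1 ≠ 0) (hr₀ : (r y₀).1 ≠ 0) {N : ℕ}
    (hx₀ : -(N : ℝ) < x₀) (hy₀ : y₀ + 1 ≤ N) {S : L2R →L[ℂ] L2R}
    (hS : HasKernel S (cutKernel N (greenKernel l r))) : S ≠ 0 := by
  rintro rfl
  obtain ⟨f, m, hm, hint⟩ := exists_integral_cutKernel_eq (l := l) hr hr₀ hy₀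
  have hnull : volume {x ∈ Ioo (-(N : ℝ)) y₀ | (l x).1 ≠ 0} = 0 := by
    refine measure_mono_null (fun x hx ↦ ?_) (ae_iff.1 ((hS f).and (Lp.coeFn_zero ℂ 2 volume)))
    rintro ⟨h1, h2⟩
    refine mul_ne_zero hx.2 hm ?_
    rw [← hint x hx.1, ← h1]
    exact h2
  have hopen : IsOpen {x ∈ Ioo (-(N : ℝ)) y₀ | (l x).1 ≠ 0} :=
    isOpen_Ioo.inter (isOpen_ne.preimage hl.fst)
  exact (hopen.measure_pos volume ⟨x₀, ⟨hx₀, hxy⟩, hl₀⟩).ne' hnull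

/-- A pair of solutions depending holomorphically on the spectral parameter `lam ∈ ℂ`, which for
`lam` in the upper half plane are the decaying solutions at `-∞` and `+∞` and are independent. -/
structure IsJostFamily (a : ℝ → ℝ) (s : Set ℝ) (l r : ℂ → ℝ → ℂ × ℂ) : Prop where
  continuous_left : Continuous (Function.uncurry l)
  continuous_right : Continuous (Function.uncurry r)
  differentiable_left : ∀ x, Differentiable ℂ fun lam ↦ l lam x
  differentiable_right : ∀ x, Differentiable ℂ fun lam ↦ r lam x
  exists_isDecayingPair : ∀ lam : ℂ, 0 < lam.im → ∃ η, IsDecayingPair a s lam η (l lam) (r lam)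
  wronskian_ne_zero : ∀ lam : ℂ, 0 < lam.im → wronskian (l lam 0) (r lam 0) ≠ 0
  exists_ne_zero : ∀ lam, ∃ x y, x < y ∧ (l lam x).1 ≠ 0 ∧ (r lam y).1 ≠ 0

namespace IsJostFamily

variable {a : ℝ → ℝ} {s : Set ℝ} {l r : ℂ → ℝ → ℂ × ℂ}

theorem continuous_left_apply (h : IsJostFamily a s l r) (lam : ℂ) : Continuous (l lam) :=
  h.continuous_left.comp (.prodMk_right lam)

theorem continuous_right_apply (h : IsJostFamily a s l r) (lam : ℂ) : Continuous (r lam) :=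
  h.continuous_right.comp (.prodMk_right lam)

theorem differentiable_greenKernel (h : IsJostFamily a s l r) (x y : ℝ) :
    Differentiable ℂ fun lam ↦ greenKernel (l lam) (r lam) x y := by
  simp only [greenKernel, splitKernel]
  split_ifs
  · exact (h.differentiable_left x).fst.mul (h.differentiable_right y).fst
  · exact (h.differentiable_right x).fst.mul (h.differentiable_left y).fst

theorem exists_bound_greenKernel (h : IsJostFamily a s l r) (N : ℕ) (ϱ : ℝ) :
    ∃ C : ℝ≥0, ∀ lam ∈ Metric.closedBall 0 ϱ, ∀ p ∈ Icc (-(N : ℝ)) N ×ˢ Icc (-(N : ℝ)) N,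
      ‖greenKernel (l lam) (r lam) p.1 p.2‖ ≤ C := by
  have hcomp : IsCompact (Metric.closedBall (0 : ℂ) ϱ ×ˢ Icc (-(N : ℝ)) N) :=
    (isCompact_closedBall 0 ϱ).prod isCompact_Icc
  obtain ⟨Cl, hCl⟩ := hcomp.exists_bound_of_continuousOn h.continuous_left.continuousOn
  obtain ⟨Cr, hCr⟩ := hcomp.exists_bound_of_continuousOn h.continuous_right.continuousOn
  refine ⟨(|Cl| * |Cr|).toNNReal, fun lam hlam p hp ↦ ?_⟩
  have hl (z : ℝ) (hz : z ∈ Icc (-(N : ℝ)) N) : ‖(l lam z).1‖ ≤ |Cl| :=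
    (norm_fst_le _).trans ((hCl (lam, z) ⟨hlam, hz⟩).trans (le_abs_self _))
  have hr (z : ℝ) (hz : z ∈ Icc (-(N : ℝ)) N) : ‖(r lam z).1‖ ≤ |Cr| :=
    (norm_fst_le _).trans ((hCr (lam, z) ⟨hlam, hz⟩).trans (le_abs_self _))
  rw [Real.coe_toNNReal _ (by positivity), greenKernel, splitKernel]
  split_ifs
  · exact norm_mul_le_of_le (hl _ hp.1) (hr _ hp.2)
  · rw [mul_comm]
    exact norm_mul_le_of_le (hl _ hp.2) (hr _ hp.1)

theorem isEntireKernelFamily (h : IsJostFamily a s l r) (N : ℕ) :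
    IsEntireKernelFamily (Icc (-(N : ℝ)) N) (Icc (-(N : ℝ)) N)
      fun lam ↦ cutKernel N (greenKernel (l lam) (r lam)) where
  measurable lam := by
    obtain ⟨hl, hr⟩ := And.intro (h.continuous_left_apply lam) (h.continuous_right_apply lam)
    exact (measurable_splitKernel hl.fst.measurable hr.fst.measurable hl.fst.measurable
      hr.fst.measurable).indicator (measurableSet_Icc.prod measurableSet_Icc)
  eq_zero lam x y hxy := indicator_of_notMem hxy _
  differentiable x y := by
    simp only [cutKernel, indicator_apply]
    split_ifs
    · exact h.differentiable_greenKernel x y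
    · exact differentiable_const 0
  exists_bound ϱ := by
    obtain ⟨C, hC⟩ := h.exists_bound_greenKernel N ϱ
    refine ⟨C, fun lam hlam x y ↦ ?_⟩
    rw [cutKernel, indicator_apply]
    split_ifs with hxy
    · exact hC lam hlam _ hxy
    · simp

theorem exists_differentiable_hasKernel (h : IsJostFamily a s l r) (N : ℕ) :
    ∃ S : ℂ → L2R →L[ℂ] L2R, Differentiable ℂ S ∧
      ∀ lam, HasKernel (S lam) (cutKernel N (greenKernel (l lam) (r lam))) :=
  (h.isEntireKernelFamily N).exists_differentiable_hasKernel measurableSet_Icc measurableSet_Icc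
    (by simp) (by simp)

theorem differentiable_mul_wronskian (h : IsJostFamily a s l r) :
    Differentiable ℂ fun lam ↦ lam * wronskian (l lam 0) (r lam 0) :=
  differentiable_id.mul (((h.differentiable_left 0).fst.mul (h.differentiable_right 0).snd).sub
    ((h.differentiable_right 0).fst.mul (h.differentiable_left 0).snd))

theorem isContinuedResolvent_smul (h : IsJostFamily a s l r) (ha : IsRegularCoeff a s) {N : ℕ}
    {S : ℂ → L2R →L[ℂ] L2R} (hSd : Differentiable ℂ S)
    (hS : ∀ lam, HasKernel (S lam) (cutKernel N (greenKernel (l lam) (r lam)))) :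
    IsContinuedResolvent a N ((fun lam ↦ I / (lam * wronskian (l lam 0) (r lam 0))) • S) := by
  refine ⟨fun lam ↦ ((MeromorphicAt.const I lam).div
    (h.differentiable_mul_wronskian.analyticAt lam).meromorphicAt).smul
      (hSd.analyticAt lam).meromorphicAt, fun lam hlam ↦ ?_⟩
  have hlam0 : lam ≠ 0 := by
    rintro rfl
    exact lt_irrefl _ hlam
  obtain ⟨η, hη⟩ := h.exists_isDecayingPair lam hlam
  obtain ⟨G, hG, hR⟩ := hη.exists_isResolventAt ha hlam0 (h.wronskian_ne_zero lam hlam)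
  refine ⟨_, hR, ?_⟩
  rw [Pi.smul_apply', (hS lam).unique (hG.cutoff_comp N)]
  simp

theorem exists_isContinuedResolvent (h : IsJostFamily a s l r) (ha : IsRegularCoeff a s) (N : ℕ) :
    ∃ T, IsContinuedResolvent a N T := by
  obtain ⟨S, hSd, hS⟩ := h.exists_differentiable_hasKernel N
  exact ⟨_, h.isContinuedResolvent_smul ha hSd hS⟩

theorem wronskian_eq_zero_of_mem_Res (h : IsJostFamily a s l r) (ha : IsRegularCoeff a s) {lam : ℂ}
    (hlam : lam ∈ Res a) : wronskian (l lam 0) (r lam 0) = 0 := by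
  obtain ⟨him, N, T, hT, hord⟩ := hlam
  by_contra hne
  obtain ⟨S, hSd, hS⟩ := h.exists_differentiable_hasKernel N
  rw [hT.meromorphicOrderAt_eq (h.isContinuedResolvent_smul ha hSd hS)] at hord
  have hlam0 : lam ≠ 0 := by
    rintro rfl
    exact lt_irrefl _ him
  exact hord.not_ge ((analyticAt_const.div (h.differentiable_mul_wronskian.analyticAt lam)
    (mul_ne_zero hlam0 hne)).smul (hSd.analyticAt lam)).meromorphicOrderAt_nonneg

theorem mem_Res_of_wronskian_eq_zero (h : IsJostFamily a s l r) (ha : IsRegularCoeff a s) {lam : ℂ}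
    (him : lam.im < 0) (hlam : wronskian (l lam 0) (r lam 0) = 0) : lam ∈ Res a := by
  obtain ⟨x, y, hxy, hx, hy⟩ := h.exists_ne_zero lam
  obtain ⟨N, hN⟩ := exists_nat_gt (max (-x) (y + 1))
  obtain ⟨hNx, hNy⟩ := max_lt_iff.1 hN
  obtain ⟨S, hSd, hS⟩ := h.exists_differentiable_hasKernel N
  have hW := h.differentiable_mul_wronskian
  refine ⟨him, N, _, h.isContinuedResolvent_smul ha hSd hS, meromorphicOrderAt_div_smul_neg
    (hW.analyticAt lam) (hSd.analyticAt lam)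
    (meromorphicOrderAt_ne_top_of_meromorphic (fun z ↦ (hW.analyticAt z).meromorphicAt) (z := I)
      ?_ lam) (by rw [hlam, mul_zero])
    (ne_zero_of_hasKernel_cutKernel (h.continuous_left_apply lam) (h.continuous_right_apply lam)
      hxy hx hy (neg_lt.1 hNx) hNy.le (hS lam)) Complex.I_ne_zero⟩
  rw [meromorphicOrderAt_ne_top_iff_eventually_ne_zero (hW.analyticAt I).meromorphicAt]
  exact (hW.continuous.continuousAt.eventually_ne (mul_ne_zero Complex.I_ne_zero
    (h.wronskian_ne_zero I (by simp)))).filter_mono nhdsWithin_le_nhds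

theorem mem_Res_iff (h : IsJostFamily a s l r) (ha : IsRegularCoeff a s) (lam : ℂ) :
    lam ∈ Res a ↔ lam.im < 0 ∧ wronskian (l lam 0) (r lam 0) = 0 :=
  ⟨fun hlam ↦ ⟨hlam.1, h.wronskian_eq_zero_of_mem_Res ha hlam⟩,
    fun ⟨him, h0⟩ ↦ h.mem_Res_of_wronskian_eq_zero ha him h0⟩

end IsJostFamily

/-! ### Layered media -/

/-- The transfer map of a homogeneous layer `a = b⁻²` of optical thickness `θ = lam b ℓ`, in the
coordinates `(u, v)` of `IsSolution`. -/
def layer (b : ℝ) (θ : ℂ) (w : ℂ × ℂ) : ℂ × ℂ :=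
  (Complex.cos θ * w.1 + I * b * Complex.sin θ * w.2,
    I / b * Complex.sin θ * w.1 + Complex.cos θ * w.2)

section Layer

variable {b : ℝ}

theorem layer_zero (b : ℝ) (w : ℂ × ℂ) : layer b 0 w = w := by
  simp [layer]

theorem layer_layer (hb : b ≠ 0) (θ θ' : ℂ) (w : ℂ × ℂ) :
    layer b θ (layer b θ' w) = layer b (θ + θ') w := by
  have hb' : (b : ℂ) ≠ 0 := by exact_mod_cast hb
  simp only [layer, Complex.cos_add, Complex.sin_add]
  ext <;> field_simp
  · linear_combination (Complex.sin θ * Complex.sin θ' * w.1) * Complex.I_mul_I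
  · linear_combination (Complex.sin θ * Complex.sin θ' * w.2 * b) * Complex.I_mul_I

theorem wronskian_layer (hb : b ≠ 0) (θ : ℂ) (w z : ℂ × ℂ) :
    wronskian (layer b θ w) (layer b θ z) = wronskian w z := by
  have hb' : (b : ℂ) ≠ 0 := by exact_mod_cast hb
  simp only [layer, wronskian]
  field_simp
  linear_combination (w.1 * z.2 - w.2 * z.1) * b * Complex.sin_sq_add_cos_sq θ -
    Complex.sin θ ^ 2 * (w.1 * z.2 - w.2 * z.1) * b * Complex.I_mul_I

theorem layer_add_mul (hb : b ≠ 0) (θ : ℂ) (w : ℂ × ℂ) :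
    (layer b θ w).1 + b * (layer b θ w).2 = Complex.exp (θ * I) * (w.1 + b * w.2) := by
  have hb' : (b : ℂ) ≠ 0 := by exact_mod_cast hb
  rw [Complex.exp_mul_I]
  simp only [layer]
  field_simp
  ring

theorem layer_sub_mul (hb : b ≠ 0) (θ : ℂ) (w : ℂ × ℂ) :
    (layer b θ w).1 - b * (layer b θ w).2 = Complex.exp (-θ * I) * (w.1 - b * w.2) := by
  have hb' : (b : ℂ) ≠ 0 := by exact_mod_cast hb
  rw [Complex.exp_mul_I, Complex.cos_neg, Complex.sin_neg]
  simp only [layer]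
  field_simp
  ring

theorem layer_eq_add (hb : b ≠ 0) (θ : ℂ) (w : ℂ × ℂ) :
    layer b θ w = (Complex.exp (θ * I) * ((w.1 + b * w.2) / (2 * b))) • ((b : ℂ), (1 : ℂ)) +
      (Complex.exp (-θ * I) * ((w.1 - b * w.2) / (2 * b))) • ((b : ℂ), (-1 : ℂ)) := by
  have hb' : (b : ℂ) ≠ 0 := by exact_mod_cast hb
  have hadd := layer_add_mul hb θ w
  have hsub := layer_sub_mul hb θ w
  ext <;> simp only [Prod.fst_add, Prod.snd_add, Prod.smul_fst, Prod.smul_snd, smul_eq_mul] <;>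
    rw [← mul_div_assoc, ← mul_div_assoc, ← hadd, ← hsub] <;> field_simp <;> ring

theorem layer_rightGoing (hb : b ≠ 0) (θ : ℂ) :
    layer b θ (b, 1) = Complex.exp (θ * I) • ((b : ℂ), (1 : ℂ)) := by
  have hb' : (b : ℂ) ≠ 0 := by exact_mod_cast hb
  rw [layer_eq_add hb, mul_one, sub_self, ← two_mul, div_self (mul_ne_zero two_ne_zero hb')]
  simp

theorem layer_leftGoing (hb : b ≠ 0) (θ : ℂ) :
    layer b θ (b, -1) = Complex.exp (-θ * I) • ((b : ℂ), (-1 : ℂ)) := by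
  have hb' : (b : ℂ) ≠ 0 := by exact_mod_cast hb
  rw [layer_eq_add hb, mul_neg_one, ← sub_eq_add_neg, sub_self, sub_neg_eq_add, ← two_mul,
    div_self (mul_ne_zero two_ne_zero hb')]
  simp

theorem exists_norm_layer_le (hb : b ≠ 0) (w : ℂ × ℂ) :
    ∃ C, ∀ θ : ℂ, ‖layer b θ w‖ ≤ C * Real.exp |θ.im| := by
  have hexp (z : ℂ) : ‖Complex.exp (z * I)‖ ≤ Real.exp |z.im| := by
    rw [Complex.norm_exp, Real.exp_le_exp]
    simpa using neg_le_abs z.im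
  have hexp' (z : ℂ) : ‖Complex.exp (-z * I)‖ ≤ Real.exp |z.im| := by
    simpa using hexp (-z)
  refine ⟨‖(w.1 + b * w.2) / (2 * b)‖ * ‖((b : ℂ), (1 : ℂ))‖ +
    ‖(w.1 - b * w.2) / (2 * b)‖ * ‖((b : ℂ), (-1 : ℂ))‖, fun θ ↦ ?_⟩
  rw [layer_eq_add hb, add_mul]
  refine (norm_add_le _ _).trans (add_le_add ?_ ?_) <;>
    rw [norm_smul, norm_mul, mul_assoc, mul_comm]
  · exact mul_le_mul_of_nonneg_left (hexp θ) (by positivity)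
  · exact mul_le_mul_of_nonneg_left (hexp' θ) (by positivity)

theorem continuous_layer {X : Type*} [TopologicalSpace X] (b : ℝ) {θ : X → ℂ} {w : X → ℂ × ℂ}
    (hθ : Continuous θ) (hw : Continuous w) : Continuous fun p ↦ layer b (θ p) (w p) := by
  unfold layer
  fun_prop

theorem differentiable_layer (b : ℝ) {θ : ℂ → ℂ} {w : ℂ → ℂ × ℂ} (hθ : Differentiable ℂ θ)
    (hw : Differentiable ℂ w) : Differentiable ℂ fun lam ↦ layer b (θ lam) (w lam) := by
  unfold layer
  fun_prop

theorem isSolution_layer (hb : b ≠ 0) (lam : ℂ) (w : ℂ × ℂ) :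
    IsSolution (fun _ ↦ (b ^ 2)⁻¹) ∅ lam fun x ↦ layer b (lam * b * x) w := by
  have hb' : (b : ℂ) ≠ 0 := by exact_mod_cast hb
  have h0 (x : ℝ) : HasDerivAt (fun z : ℂ ↦ lam * b * z) (lam * b) x := by
    simpa using (hasDerivAt_id (x : ℂ)).const_mul (lam * b)
  have hs (x : ℝ) := (h0 x).csin.comp_ofReal
  have hc (x : ℝ) := (h0 x).ccos.comp_ofReal
  refine ⟨continuous_layer b (by fun_prop) continuous_const, fun x _ ↦ ?_, fun x _ ↦ ?_⟩
  · refine (((hc x).mul_const w.1).add (((hs x).const_mul (I * b)).mul_const w.2)).congr_deriv ?_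
    simp only [layer]
    push_cast
    generalize Complex.sin (lam * b * x) = S
    field_simp
    linear_combination (-lam * S * w.1) * Complex.I_mul_I
  · refine ((((hs x).const_mul (I / b)).mul_const w.1).add ((hc x).mul_const w.2)).congr_deriv ?_
    simp only [layer]
    generalize Complex.sin (lam * b * x) = S
    field_simp
    linear_combination (-lam * b * S * w.2) * Complex.I_mul_I

end Layer

section Gluing

variable {a a' : ℝ → ℝ} {s s' : Set ℝ} {lam : ℂ} {Z Z' : ℝ → ℂ × ℂ} {c : ℝ}

theorem IsSolution.glue (h : IsSolution a s lam Z) (h' : IsSolution a' s' lam Z')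
    (hc : Z c = Z' c) :
    IsSolution (fun x ↦ if x < c then a x else a' x) (insert c (s ∪ s')) lam
      fun x ↦ if x ≤ c then Z x else Z' x := by
  have hlt {x : ℝ} (hx : x < c) : (fun y ↦ if y ≤ c then Z y else Z' y) =ᶠ[𝓝 x] Z := by
    filter_upwards [eventually_lt_nhds hx] with y hy using if_pos hy.le
  have hgt {x : ℝ} (hx : c < x) : (fun y ↦ if y ≤ c then Z y else Z' y) =ᶠ[𝓝 x] Z' := by
    filter_upwards [eventually_gt_nhds hx] with y hy using if_neg hy.not_ge
  refine ⟨h.continuous.if_le h'.continuous continuous_id continuous_const fun x hx ↦ hx ▸ hc,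
    fun x hx ↦ ?_, fun x hx ↦ ?_⟩ <;>
  · simp only [mem_insert_iff, mem_union, not_or] at hx
    obtain ⟨hxc, hxs, hxs'⟩ := hx
    rcases lt_or_gt_of_ne hxc with hxc | hxc
    · simp only [if_pos hxc, if_pos hxc.le]
      first
      | exact (h.hasDerivAt_fst x hxs).congr_of_eventuallyEq ((hlt hxc).fun_comp Prod.fst)
      | exact (h.hasDerivAt_snd x hxs).congr_of_eventuallyEq ((hlt hxc).fun_comp Prod.snd)
    · simp only [if_neg hxc.not_gt, if_neg hxc.not_ge]
      first
      | exact (h'.hasDerivAt_fst x hxs').congr_of_eventuallyEq ((hgt hxc).fun_comp Prod.fst)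
      | exact (h'.hasDerivAt_snd x hxs').congr_of_eventuallyEq ((hgt hxc).fun_comp Prod.snd)

theorem IsSolution.comp_sub_const (h : IsSolution a s lam Z) (c : ℝ) :
    IsSolution (fun x ↦ a (x - c)) ((· - c) ⁻¹' s) lam fun x ↦ Z (x - c) :=
  ⟨h.continuous.comp (continuous_id.sub continuous_const),
    fun x hx ↦ (h.hasDerivAt_fst _ hx).comp_sub_const x c,
    fun x hx ↦ (h.hasDerivAt_snd _ hx).comp_sub_const x c⟩

theorem IsRegularCoeff.const {α : ℝ} (hα : α ≠ 0) : IsRegularCoeff (fun _ ↦ α) ∅ :=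
  ⟨countable_empty, measurable_const, fun _ ↦ hα, ⟨_, fun _ ↦ le_rfl⟩,
    fun _ _ ↦ continuousAt_const⟩

theorem IsRegularCoeff.glue (h : IsRegularCoeff a s) (h' : IsRegularCoeff a' s') (c : ℝ) :
    IsRegularCoeff (fun x ↦ if x < c then a x else a' x) (insert c (s ∪ s')) where
  countable := (h.countable.union h'.countable).insert c
  measurable := h.measurable.ite measurableSet_Iio h'.measurable
  ne_zero x := by
    split_ifs
    exacts [h.ne_zero x, h'.ne_zero x]
  exists_bound := by
    obtain ⟨B, hB⟩ := h.exists_bound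
    obtain ⟨B', hB'⟩ := h'.exists_bound
    refine ⟨max B B', fun x ↦ ?_⟩
    split_ifs
    exacts [(hB x).trans (le_max_left _ _), (hB' x).trans (le_max_right _ _)]
  continuousAt x hx := by
    simp only [mem_insert_iff, mem_union, not_or] at hx
    obtain ⟨hxc, hxs, hxs'⟩ := hx
    rcases lt_or_gt_of_ne hxc with hxc | hxc
    · exact (h.continuousAt x hxs).congr
        ((eventually_lt_nhds hxc).mono fun y hy ↦ (if_pos hy).symm)
    · exact (h'.continuousAt x hxs').congr
        ((eventually_gt_nhds hxc).mono fun y hy ↦ (if_neg hy.not_gt).symm)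

theorem IsRegularCoeff.comp_sub_const (h : IsRegularCoeff a s) (c : ℝ) :
    IsRegularCoeff (fun x ↦ a (x - c)) ((· - c) ⁻¹' s) where
  countable := h.countable.preimage_of_injOn (sub_left_injective.injOn)
  measurable := h.measurable.comp (measurable_id.sub_const c)
  ne_zero x := h.ne_zero _
  exists_bound := h.exists_bound.imp fun B hB x ↦ hB _
  continuousAt x hx := (h.continuousAt _ hx).comp (f := (· - c)) (by fun_prop)

end Gluing

/-- The coefficient equal to `b₀⁻²` off the layers listed in `L`, which are stacked from `0` to the
right; `(b, ℓ)` stands for a layer of length `ℓ` on which the coefficient is `b⁻²`. -/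
def layeredCoeff (b₀ : ℝ) : List (ℝ × ℝ) → ℝ → ℝ
  | [] => fun _ ↦ (b₀ ^ 2)⁻¹
  | p :: L => fun x ↦
      if x < 0 then (b₀ ^ 2)⁻¹ else if x < p.2 then (p.1 ^ 2)⁻¹ else layeredCoeff b₀ L (x - p.2)

/-- The points between the layers of `layeredCoeff`. -/
def interfaces : List (ℝ × ℝ) → Set ℝ
  | [] => ∅
  | p :: L => insert 0 (∅ ∪ insert p.2 (∅ ∪ (· - p.2) ⁻¹' interfaces L))

/-- The solution in the medium `layeredCoeff b₀ L` with value `w` at `0`. -/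
def layeredSol (b₀ : ℝ) (lam : ℂ) : List (ℝ × ℝ) → ℂ × ℂ → ℝ → ℂ × ℂ
  | [], w => fun x ↦ layer b₀ (lam * b₀ * x) w
  | p :: L, w => fun x ↦
      if x ≤ 0 then layer b₀ (lam * b₀ * x) w
      else if x ≤ p.2 then layer p.1 (lam * p.1 * x) w
      else layeredSol b₀ lam L (layer p.1 (lam * p.1 * p.2) w) (x - p.2)

/-- The transfer map across the layers in `L`, from left to right. -/
def transfer (lam : ℂ) (L : List (ℝ × ℝ)) (w : ℂ × ℂ) : ℂ × ℂ :=
  L.foldl (fun w p ↦ layer p.1 (lam * p.1 * p.2) w) w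

theorem transfer_cons (lam : ℂ) (p : ℝ × ℝ) (L : List (ℝ × ℝ)) (w : ℂ × ℂ) :
    transfer lam (p :: L) w = transfer lam L (layer p.1 (lam * p.1 * p.2) w) := rfl

section Layered

variable {b₀ : ℝ} {L : List (ℝ × ℝ)} {lam : ℂ} {w z : ℂ × ℂ} {x : ℝ}

theorem isRegularCoeff_layeredCoeff (hb₀ : b₀ ≠ 0) (hL : ∀ p ∈ L, p.1 ≠ 0) :
    IsRegularCoeff (layeredCoeff b₀ L) (interfaces L) := by
  induction L with
  | nil => exact .const (inv_ne_zero (pow_ne_zero 2 hb₀))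
  | cons p L ih =>
    obtain ⟨hp, hL⟩ := List.forall_mem_cons.1 hL
    exact (IsRegularCoeff.const (inv_ne_zero (pow_ne_zero 2 hb₀))).glue
      ((IsRegularCoeff.const (inv_ne_zero (pow_ne_zero 2 hp))).glue ((ih hL).comp_sub_const p.2)
        p.2) 0

theorem layeredCoeff_of_neg (b₀ : ℝ) (L : List (ℝ × ℝ)) (hx : x < 0) :
    layeredCoeff b₀ L x = (b₀ ^ 2)⁻¹ := by
  cases L with
  | nil => rfl
  | cons p L => exact if_pos hx

theorem layeredSol_of_nonpos (b₀ : ℝ) (lam : ℂ) (L : List (ℝ × ℝ)) (w : ℂ × ℂ) (hx : x ≤ 0) :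
    layeredSol b₀ lam L w x = layer b₀ (lam * b₀ * x) w := by
  cases L with
  | nil => rfl
  | cons p L => exact if_pos hx

theorem layeredSol_zero (b₀ : ℝ) (lam : ℂ) (L : List (ℝ × ℝ)) (w : ℂ × ℂ) :
    layeredSol b₀ lam L w 0 = w := by
  rw [layeredSol_of_nonpos _ _ _ _ le_rfl, Complex.ofReal_zero, mul_zero, layer_zero]

theorem layeredSol_of_sum_lt (hL : ∀ p ∈ L, 0 < p.2) (hx : (L.map Prod.snd).sum < x) :
    layeredSol b₀ lam L w x =
      layer b₀ (lam * b₀ * (x - (L.map Prod.snd).sum : ℝ)) (transfer lam L w) := by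
  induction L generalizing w x with
  | nil => simp [layeredSol, transfer]
  | cons p L ih =>
    obtain ⟨hp, hL⟩ := List.forall_mem_cons.1 hL
    have hsum : 0 ≤ (L.map Prod.snd).sum :=
      List.sum_nonneg (List.forall_mem_map.2 fun q hq ↦ (hL q hq).le)
    rw [List.map_cons, List.sum_cons] at hx ⊢
    simp only [layeredSol]
    rw [if_neg (by linarith), if_neg (by linarith), ih hL (by linarith), sub_sub]
    rfl

theorem isSolution_layeredSol (hb₀ : b₀ ≠ 0) (hL : ∀ p ∈ L, p.1 ≠ 0 ∧ 0 < p.2) :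
    IsSolution (layeredCoeff b₀ L) (interfaces L) lam (layeredSol b₀ lam L w) := by
  induction L generalizing w with
  | nil => exact isSolution_layer hb₀ lam w
  | cons p L ih =>
    obtain ⟨⟨hp1, hp2⟩, hL⟩ := List.forall_mem_cons.1 hL
    refine (isSolution_layer hb₀ lam w).glue
      ((isSolution_layer hp1 lam w).glue ((ih hL).comp_sub_const p.2) ?_) ?_
    · simp only [sub_self, layeredSol_zero]
    · simp only [if_pos hp2.le, Complex.ofReal_zero, mul_zero, layer_zero]

theorem continuous_layeredSol {X : Type*} [TopologicalSpace X] (hL : ∀ p ∈ L, 0 < p.2)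
    {lam : X → ℂ} {w : X → ℂ × ℂ} {ξ : X → ℝ} (hlam : Continuous lam) (hw : Continuous w)
    (hξ : Continuous ξ) : Continuous fun t ↦ layeredSol b₀ (lam t) L (w t) (ξ t) := by
  induction L generalizing w ξ with
  | nil => exact continuous_layer b₀ (by fun_prop) hw
  | cons p L ih =>
    obtain ⟨hp, hL⟩ := List.forall_mem_cons.1 hL
    refine (continuous_layer b₀ (by fun_prop) hw).if_le
      ((continuous_layer p.1 (by fun_prop) hw).if_le
        (ih hL (continuous_layer p.1 (by fun_prop) hw) (hξ.sub continuous_const))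
        hξ continuous_const fun t ht ↦ ?_) hξ continuous_const fun t ht ↦ ?_
    · rw [ht, sub_self, layeredSol_zero]
    · rw [ht, if_pos hp.le, Complex.ofReal_zero, mul_zero, mul_zero, layer_zero, layer_zero]

theorem differentiable_layeredSol (b₀ : ℝ) (L : List (ℝ × ℝ)) (x : ℝ) {w : ℂ → ℂ × ℂ}
    (hw : Differentiable ℂ w) : Differentiable ℂ fun lam ↦ layeredSol b₀ lam L (w lam) x := by
  induction L generalizing w x with
  | nil => exact differentiable_layer b₀ (by fun_prop) hw
  | cons p L ih =>
    simp only [layeredSol]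
    split_ifs
    · exact differentiable_layer b₀ (by fun_prop) hw
    · exact differentiable_layer p.1 (by fun_prop) hw
    · exact ih _ (differentiable_layer p.1 (by fun_prop) hw)

theorem differentiable_transfer (L : List (ℝ × ℝ)) {ζ : ℂ → ℂ} {w : ℂ → ℂ × ℂ}
    (hζ : Differentiable ℂ ζ) (hw : Differentiable ℂ w) :
    Differentiable ℂ fun lam ↦ transfer (ζ lam) L (w lam) := by
  induction L generalizing w with
  | nil => exact hw
  | cons p _ ih => exact ih (differentiable_layer p.1 (by fun_prop) hw)

theorem wronskian_transfer (hL : ∀ p ∈ L, p.1 ≠ 0) :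
    wronskian (transfer lam L w) (transfer lam L z) = wronskian w z := by
  induction L generalizing w z with
  | nil => rfl
  | cons p L ih =>
    obtain ⟨hp, hL⟩ := List.forall_mem_cons.1 hL
    exact (ih hL).trans (wronskian_layer hp _ w z)

theorem transfer_transfer_neg_reverse (hL : ∀ p ∈ L, p.1 ≠ 0) (lam : ℂ) (w : ℂ × ℂ) :
    transfer lam L (transfer (-lam) L.reverse w) = w := by
  induction L generalizing w with
  | nil => rfl
  | cons p L ih =>
    obtain ⟨hp, hL⟩ := List.forall_mem_cons.1 hL
    simp only [transfer, List.reverse_cons, List.foldl_append, List.foldl_cons, List.foldl_nil]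
    rw [layer_layer hp, ← add_mul, ← add_mul, add_neg_cancel, zero_mul, zero_mul, layer_zero]
    exact ih hL w

end Layered

/-! ### Jost solutions of layered media -/

theorem isBigO_top_of_cocompact {X E F : Type*} [TopologicalSpace X] [NormedAddCommGroup E]
    [NormedAddCommGroup F] {f : X → E} {g : X → F} (hf : Continuous f) (hg : Continuous g)
    (hg₀ : ∀ x, g x ≠ 0) (h : f =O[cocompact X] g) : f =O[⊤] g := by
  obtain ⟨C, hC⟩ := h.bound
  obtain ⟨t, ht, htC⟩ := mem_cocompact.1 hC
  rw [← principal_univ, ← union_compl_self t, ← sup_principal]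
  exact ((hf.continuousOn.isBigO_principal ht (c := (1 : ℝ)) (by norm_num)).trans
    (hg.continuousOn.isBigO_rev_principal ht (fun x _ ↦ hg₀ x) 1)).sup (.of_bound C htC)

/-- The energy flux of `(u, v)` to the right. -/
def flux (w : ℂ × ℂ) : ℝ := (w.1 * (starRingEnd ℂ) w.2).re

theorem four_mul_flux (b : ℝ) (w : ℂ × ℂ) :
    4 * b * flux w = ‖w.1 + b * w.2‖ ^ 2 - ‖w.1 - b * w.2‖ ^ 2 := by
  rw [← Complex.normSq_eq_norm_sq, ← Complex.normSq_eq_norm_sq, Complex.normSq_apply,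
    Complex.normSq_apply, flux]
  simp only [Complex.mul_re, Complex.mul_im, Complex.conj_re, Complex.conj_im, Complex.add_re,
    Complex.add_im, Complex.sub_re, Complex.sub_im, Complex.ofReal_re, Complex.ofReal_im]
  ring

theorem four_mul_flux_layer {b : ℝ} (hb : b ≠ 0) (θ : ℂ) (w : ℂ × ℂ) :
    4 * b * flux (layer b θ w) = Real.exp (-2 * θ.im) * ‖w.1 + b * w.2‖ ^ 2
      - Real.exp (2 * θ.im) * ‖w.1 - b * w.2‖ ^ 2 := by
  rw [four_mul_flux, layer_add_mul hb, layer_sub_mul hb, norm_mul, norm_mul, mul_pow, mul_pow,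
    Complex.norm_exp, Complex.norm_exp, ← Real.exp_nat_mul, ← Real.exp_nat_mul]
  simp

theorem flux_layer_le {b : ℝ} (hb : 0 < b) {θ : ℂ} (hθ : 0 ≤ θ.im) (w : ℂ × ℂ) :
    flux (layer b θ w) ≤ flux w := by
  have hexp : Real.exp (-2 * θ.im) ≤ 1 := Real.exp_le_one_iff.2 (by linarith)
  have hexp' : 1 ≤ Real.exp (2 * θ.im) := Real.one_le_exp (by linarith)
  refine le_of_mul_le_mul_left (a := 4 * b) ?_ (by positivity)
  rw [four_mul_flux_layer hb.ne', four_mul_flux]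
  exact sub_le_sub (mul_le_of_le_one_left (sq_nonneg _) hexp)
    (le_mul_of_one_le_left (sq_nonneg _) hexp')

theorem im_mul_ofReal_mul_ofReal (lam : ℂ) (b x : ℝ) : (lam * b * x).im = lam.im * b * x := by
  simp

theorem flux_transfer_le {L : List (ℝ × ℝ)} (hL : ∀ p ∈ L, 0 < p.1 ∧ 0 < p.2) {lam : ℂ}
    (hlam : 0 ≤ lam.im) (w : ℂ × ℂ) : flux (transfer lam L w) ≤ flux w := by
  induction L generalizing w with
  | nil => exact le_rfl
  | cons p L ih =>
    obtain ⟨⟨hb, hℓ⟩, hL⟩ := List.forall_mem_cons.1 hL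
    refine (ih hL _).trans (flux_layer_le hb ?_ w)
    rw [im_mul_ofReal_mul_ofReal]
    positivity

/-- The solution that is purely left-going to the left of the layers. -/
def jostLeft (b₀ : ℝ) (L : List (ℝ × ℝ)) (lam : ℂ) : ℝ → ℂ × ℂ :=
  layeredSol b₀ lam L (b₀, -1)

/-- The solution that is purely right-going to the right of the layers; its value at `0` is obtained
by transporting `(b₀, 1)` back through the layers. -/
def jostRight (b₀ : ℝ) (L : List (ℝ × ℝ)) (lam : ℂ) : ℝ → ℂ × ℂ :=
  layeredSol b₀ lam L (transfer (-lam) L.reverse (b₀, 1))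

/-- The Wronskian of the two Jost solutions; it vanishes when they are proportional. -/
def jostDet (b₀ : ℝ) (L : List (ℝ × ℝ)) (lam : ℂ) : ℂ :=
  wronskian (transfer lam L (b₀, -1)) (b₀, 1)

section Jost

variable {b₀ : ℝ} {L : List (ℝ × ℝ)} {lam : ℂ} {x : ℝ}

theorem wronskian_jostLeft_jostRight (hL : ∀ p ∈ L, p.1 ≠ 0) (lam : ℂ) :
    wronskian (jostLeft b₀ L lam 0) (jostRight b₀ L lam 0) = jostDet b₀ L lam := by
  rw [jostLeft, jostRight, layeredSol_zero, layeredSol_zero, ← wronskian_transfer (lam := lam) hL,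
    transfer_transfer_neg_reverse hL, jostDet]

theorem jostDet_ne_zero (hb₀ : 0 < b₀) (hL : ∀ p ∈ L, 0 < p.1 ∧ 0 < p.2) (hlam : 0 ≤ lam.im) :
    jostDet b₀ L lam ≠ 0 := by
  intro h
  have hle := flux_transfer_le hL hlam (b₀, -1)
  rw [jostDet, wronskian] at h
  generalize transfer lam L (b₀, -1) = w at *
  have hw : w.1 = b₀ * w.2 := by linear_combination h
  have hflux : flux w = b₀ * ‖w.2‖ ^ 2 := by
    rw [flux, hw, mul_assoc, Complex.mul_conj, Complex.normSq_eq_norm_sq]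
    norm_cast
  have hneg : flux ((b₀ : ℂ), (-1 : ℂ)) = -b₀ := by simp [flux]
  have hnonneg : 0 ≤ b₀ * ‖w.2‖ ^ 2 := by positivity
  linarith

theorem jostLeft_of_nonpos (hb₀ : b₀ ≠ 0) (hx : x ≤ 0) :
    jostLeft b₀ L lam x = Complex.exp (-(lam * b₀ * x) * I) • ((b₀ : ℂ), (-1 : ℂ)) := by
  rw [jostLeft, layeredSol_of_nonpos _ _ _ _ hx, layer_leftGoing hb₀]

theorem jostRight_of_sum_lt (hb₀ : b₀ ≠ 0) (hL : ∀ p ∈ L, p.1 ≠ 0 ∧ 0 < p.2)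
    (hx : (L.map Prod.snd).sum < x) :
    jostRight b₀ L lam x = Complex.exp (lam * b₀ * (x - (L.map Prod.snd).sum : ℝ) * I) •
      ((b₀ : ℂ), (1 : ℂ)) := by
  rw [jostRight, layeredSol_of_sum_lt (fun p hp ↦ (hL p hp).2) hx,
    transfer_transfer_neg_reverse fun p hp ↦ (hL p hp).1, layer_rightGoing hb₀]

theorem isBigO_layer_exp {ι : Type*} {l : Filter ι} {b : ℝ} (hb : b ≠ 0) (w : ℂ × ℂ) {θ : ι → ℂ}
    {f : ι → ℝ} (h : ∀ᶠ i in l, |(θ i).im| ≤ f i) :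
    (fun i ↦ layer b (θ i) w) =O[l] fun i ↦ Real.exp (f i) := by
  obtain ⟨C, hC⟩ := exists_norm_layer_le hb w
  have hC₀ : 0 ≤ C := by simpa using (norm_nonneg _).trans (hC 0)
  refine .of_bound C (h.mono fun i hi ↦ (hC _).trans ?_)
  rw [Real.norm_of_nonneg (Real.exp_pos _).le]
  gcongr

theorem isBigO_jostLeft (hb₀ : 0 < b₀) (hL : ∀ p ∈ L, p.1 ≠ 0 ∧ 0 < p.2) (hlam : 0 < lam.im) :
    jostLeft b₀ L lam =O[⊤] fun x ↦ Real.exp (lam.im * b₀ * x) := by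
  have hL' (p) (hp : p ∈ L) := (hL p hp).2
  have hs : 0 ≤ (L.map Prod.snd).sum :=
    List.sum_nonneg (List.forall_mem_map.2 fun p hp ↦ (hL' p hp).le)
  refine isBigO_top_of_cocompact
    (continuous_layeredSol hL' continuous_const continuous_const continuous_id) (by fun_prop)
    (fun x ↦ (Real.exp_pos _).ne') ?_
  rw [cocompact_eq_atBot_atTop]
  refine .sup ?_ ?_
  · refine .of_bound ‖((b₀ : ℂ), (-1 : ℂ))‖ ?_
    filter_upwards [eventually_le_atBot 0] with x hx
    rw [jostLeft_of_nonpos hb₀.ne' hx, norm_smul, mul_comm, Complex.norm_exp,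
      Real.norm_of_nonneg (Real.exp_pos _).le]
    simp
  · refine (isBigO_layer_exp hb₀.ne' (transfer lam L (b₀, -1))
      (θ := fun x : ℝ ↦ lam * b₀ * (x - (L.map Prod.snd).sum : ℝ)) ?_).congr' ?_ .rfl
    · filter_upwards [eventually_gt_atTop (L.map Prod.snd).sum] with x hx
      rw [im_mul_ofReal_mul_ofReal, abs_of_nonneg (by nlinarith [mul_pos hlam hb₀])]
      gcongr
      linarith
    · filter_upwards [eventually_gt_atTop (L.map Prod.snd).sum] with x hx
        using (layeredSol_of_sum_lt hL' hx).symm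

theorem isBigO_jostRight (hb₀ : 0 < b₀) (hL : ∀ p ∈ L, p.1 ≠ 0 ∧ 0 < p.2) (hlam : 0 < lam.im) :
    jostRight b₀ L lam =O[⊤] fun x ↦ Real.exp (-(lam.im * b₀ * x)) := by
  refine isBigO_top_of_cocompact (continuous_layeredSol (fun p hp ↦ (hL p hp).2) continuous_const
    continuous_const continuous_id) (by fun_prop) (fun x ↦ (Real.exp_pos _).ne') ?_
  rw [cocompact_eq_atBot_atTop]
  refine .sup ?_ ?_
  · refine (isBigO_layer_exp hb₀.ne' (transfer (-lam) L.reverse (b₀, 1))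
      (θ := fun x : ℝ ↦ lam * b₀ * x) ?_).congr' ?_ .rfl
    · filter_upwards [eventually_le_atBot 0] with x hx
      rw [im_mul_ofReal_mul_ofReal, abs_of_nonpos (by nlinarith [mul_pos hlam hb₀])]
    · filter_upwards [eventually_le_atBot 0] with x hx
        using (layeredSol_of_nonpos _ _ _ _ hx).symm
  · refine .of_bound (Real.exp (lam.im * b₀ * (L.map Prod.snd).sum) * ‖((b₀ : ℂ), (1 : ℂ))‖) ?_
    filter_upwards [eventually_gt_atTop (L.map Prod.snd).sum] with x hx
    rw [jostRight_of_sum_lt hb₀.ne' hL hx, norm_smul, mul_right_comm (Real.exp _), Complex.norm_exp,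
      Real.norm_of_nonneg (Real.exp_pos _).le, ← Real.exp_add, Complex.mul_I_re,
      im_mul_ofReal_mul_ofReal]
    exact le_of_eq (by ring_nf)

theorem isJostFamily_layeredCoeff (hb₀ : 0 < b₀) (hL : ∀ p ∈ L, 0 < p.1 ∧ 0 < p.2) :
    IsJostFamily (layeredCoeff b₀ L) (interfaces L) (jostLeft b₀ L) (jostRight b₀ L) := by
  have hL₁ (p) (hp : p ∈ L) : p.1 ≠ 0 := (hL p hp).1.ne'
  have hL₂ (p) (hp : p ∈ L) : 0 < p.2 := (hL p hp).2
  have hL' (p) (hp : p ∈ L) : p.1 ≠ 0 ∧ 0 < p.2 := ⟨hL₁ p hp, hL₂ p hp⟩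
  have hw : Differentiable ℂ fun lam : ℂ ↦ transfer (-lam) L.reverse (b₀, 1) :=
    differentiable_transfer _ differentiable_neg (differentiable_const _)
  refine ⟨continuous_layeredSol hL₂ continuous_fst continuous_const continuous_snd,
    continuous_layeredSol hL₂ continuous_fst (hw.continuous.comp continuous_fst) continuous_snd,
    fun x ↦ differentiable_layeredSol b₀ L x (differentiable_const _),
    fun x ↦ differentiable_layeredSol b₀ L x hw, fun lam hlam ↦ ⟨lam.im * b₀, by positivity,
      isSolution_layeredSol hb₀.ne' hL', isSolution_layeredSol hb₀.ne' hL',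
      isBigO_jostLeft hb₀ hL' hlam, isBigO_jostRight hb₀ hL' hlam⟩, fun lam hlam ↦ ?_,
    fun lam ↦ ⟨0, (L.map Prod.snd).sum + 1, ?_, ?_, ?_⟩⟩
  · rw [wronskian_jostLeft_jostRight hL₁]
    exact jostDet_ne_zero hb₀ hL hlam.le
  · have := List.sum_nonneg (List.forall_mem_map.2 fun p hp ↦ (hL₂ p hp).le)
    linarith
  · simpa [jostLeft_of_nonpos hb₀.ne' le_rfl] using hb₀.ne'
  · simpa [jostRight_of_sum_lt hb₀.ne' hL' (lt_add_one _)] using hb₀.ne'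

theorem exists_isContinuedResolvent_layeredCoeff (hb₀ : 0 < b₀) (hL : ∀ p ∈ L, 0 < p.1 ∧ 0 < p.2)
    (N : ℕ) : ∃ T, IsContinuedResolvent (layeredCoeff b₀ L) N T :=
  (isJostFamily_layeredCoeff hb₀ hL).exists_isContinuedResolvent
    (isRegularCoeff_layeredCoeff hb₀.ne' fun p hp ↦ (hL p hp).1.ne') N

theorem mem_Res_layeredCoeff_iff (hb₀ : 0 < b₀) (hL : ∀ p ∈ L, 0 < p.1 ∧ 0 < p.2) :
    lam ∈ Res (layeredCoeff b₀ L) ↔ lam.im < 0 ∧ jostDet b₀ L lam = 0 := by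
  rw [(isJostFamily_layeredCoeff hb₀ hL).mem_Res_iff
    (isRegularCoeff_layeredCoeff hb₀.ne' fun p hp ↦ (hL p hp).1.ne'),
    wronskian_jostLeft_jostRight fun p hp ↦ (hL p hp).1.ne']

end Jost

section TruncatedCoeff

variable {b₁ b₂ x₂ : ℝ}

/-- The layers of `k` adjacent unit cells. -/
def cellLayers (b₁ b₂ x₂ : ℝ) : ℕ → List (ℝ × ℝ)
  | 0 => []
  | k + 1 => (b₂, x₂) :: (b₁, 1 - x₂) :: cellLayers b₁ b₂ x₂ k

theorem forall_mem_cellLayers {P : ℝ × ℝ → Prop} (h₂ : P (b₂, x₂)) (h₁ : P (b₁, 1 - x₂)) (k : ℕ) :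
    ∀ p ∈ cellLayers b₁ b₂ x₂ k, P p := by
  induction k with
  | zero => exact List.forall_mem_nil P
  | succ k ih => exact List.forall_mem_cons.2 ⟨h₂, List.forall_mem_cons.2 ⟨h₁, ih⟩⟩

theorem truncatedCoeff_succ (hx₀ : 0 < x₂) (hx₁ : x₂ < 1) (k : ℕ) (x : ℝ) :
    truncatedCoeff b₁ b₂ x₂ (k + 1) x = if x < 0 then (b₁ ^ 2)⁻¹ else
      if x < x₂ then (b₂ ^ 2)⁻¹ else truncatedCoeff b₁ b₂ x₂ k (x - 1) := by
  have : (0 : ℝ) ≤ k := k.cast_nonneg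
  unfold truncatedCoeff
  rcases lt_or_ge x 0 with h0 | h0
  · rw [if_neg (fun h ↦ h0.not_ge h.1), if_pos h0]
  rw [if_neg (not_lt.2 h0)]
  have hp : periodicCoeff b₁ b₂ x₂ (x - 1) = periodicCoeff b₁ b₂ x₂ x := by
    rw [periodicCoeff, periodicCoeff, Int.fract_sub_one]
  rcases lt_or_ge x 1 with h1 | h1
  · rw [if_pos ⟨h0, by push_cast; linarith⟩, if_neg (c := x - 1 ∈ _) (by simp [h1]),
      periodicCoeff, cellCoeff, Int.fract_eq_self.2 ⟨h0, h1⟩]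
  · rw [if_neg (c := x < x₂) (by linarith), hp]
    congr 1
    simp only [mem_Icc, Nat.cast_add, Nat.cast_one, eq_iff_iff]
    constructor <;> rintro ⟨-, h⟩ <;> constructor <;> linarith

theorem truncatedCoeff_eq_layeredCoeff (hx₀ : 0 < x₂) (hx₁ : x₂ < 1) {k : ℕ} {x : ℝ}
    (hx : x ≠ k) : truncatedCoeff b₁ b₂ x₂ k x = layeredCoeff b₁ (cellLayers b₁ b₂ x₂ k) x := by
  induction k generalizing x with
  | zero => exact if_neg (by simpa using hx)
  | succ k ih =>
    have hx' : x - 1 ≠ k := fun h ↦ hx (by push_cast; linarith)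
    rw [truncatedCoeff_succ hx₀ hx₁, ih hx']
    simp only [cellLayers, layeredCoeff, sub_sub, add_sub_cancel]
    split_ifs <;> first | rfl | linarith | exact layeredCoeff_of_neg _ _ (by linarith)

theorem truncatedCoeff_ae_eq (hx₀ : 0 < x₂) (hx₁ : x₂ < 1) (k : ℕ) :
    truncatedCoeff b₁ b₂ x₂ k =ᵐ[volume] layeredCoeff b₁ (cellLayers b₁ b₂ x₂ k) :=
  (Measure.ae_ne volume (k : ℝ)).mono fun _ ↦ truncatedCoeff_eq_layeredCoeff hx₀ hx₁

theorem exists_isContinuedResolvent_truncatedCoeff (hb₁ : 0 < b₁) (hb₂ : 0 < b₂) (hx₀ : 0 < x₂)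
    (hx₁ : x₂ < 1) (k N : ℕ) : ∃ T, IsContinuedResolvent (truncatedCoeff b₁ b₂ x₂ k) N T := by
  have h := exists_isContinuedResolvent_layeredCoeff hb₁
    (forall_mem_cellLayers ⟨hb₂, hx₀⟩ ⟨hb₁, sub_pos.2 hx₁⟩ k) N
  simpa only [IsContinuedResolvent, IsResolventAt,
    operatorGraph_congr (truncatedCoeff_ae_eq hx₀ hx₁ k)] using h

theorem mem_Res_truncatedCoeff_iff (hb₁ : 0 < b₁) (hb₂ : 0 < b₂) (hx₀ : 0 < x₂) (hx₁ : x₂ < 1)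
    {k : ℕ} {lam : ℂ} : lam ∈ Res (truncatedCoeff b₁ b₂ x₂ k) ↔
      lam.im < 0 ∧ jostDet b₁ (cellLayers b₁ b₂ x₂ k) lam = 0 := by
  rw [← mem_Res_layeredCoeff_iff hb₁ (forall_mem_cellLayers ⟨hb₂, hx₀⟩ ⟨hb₁, sub_pos.2 hx₁⟩ k)]
  simp only [Res, IsContinuedResolvent, IsResolventAt,
    operatorGraph_congr (truncatedCoeff_ae_eq hx₀ hx₁ k)]

end TruncatedCoeff

/-! ### Balanced cells -/

theorem layer_add_pi (b : ℝ) (θ : ℂ) (w : ℂ × ℂ) : layer b (θ + Real.pi) w = -layer b θ w := by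
  ext <;> simp only [layer, Complex.cos_add_pi, Complex.sin_add_pi, Prod.neg_mk] <;> ring

theorem layer_smul (b : ℝ) (θ c : ℂ) (w : ℂ × ℂ) : layer b θ (c • w) = c • layer b θ w := by
  ext <;> simp only [layer, Prod.smul_fst, Prod.smul_snd, smul_eq_mul] <;> ring

theorem transfer_smul (lam c : ℂ) (L : List (ℝ × ℝ)) (w : ℂ × ℂ) :
    transfer lam L (c • w) = c • transfer lam L w := by
  induction L generalizing w with
  | nil => rfl
  | cons p L ih =>
    rw [transfer_cons, layer_smul, ih, transfer_cons]

theorem wronskian_smul_left (c : ℂ) (w z : ℂ × ℂ) :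
    wronskian (c • w) z = c * wronskian w z := by
  simp only [wronskian, Prod.smul_fst, Prod.smul_snd, smul_eq_mul]
  ring

theorem transfer_add_of_mul_eq_pi {L : List (ℝ × ℝ)} {T : ℝ}
    (hL : ∀ p ∈ L, T * p.1 * p.2 = Real.pi) (lam : ℂ) (w : ℂ × ℂ) :
    transfer (lam + T) L w = (-1 : ℂ) ^ L.length • transfer lam L w := by
  induction L generalizing w with
  | nil => exact (one_smul ℂ w).symm
  | cons p L ih =>
    obtain ⟨hp, hL⟩ := List.forall_mem_cons.1 hL
    have hlayer : layer p.1 ((lam + T) * p.1 * p.2) w =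
        (-1 : ℂ) • layer p.1 (lam * p.1 * p.2) w := by
      rw [neg_one_smul, ← layer_add_pi, ← hp]
      push_cast
      ring_nf
    rw [transfer_cons, hlayer, ih hL, transfer_smul, transfer_cons, List.length_cons, pow_succ,
      mul_smul]

theorem jostDet_add_eq_zero_iff {L : List (ℝ × ℝ)} {T : ℝ}
    (hL : ∀ p ∈ L, T * p.1 * p.2 = Real.pi) (b₀ : ℝ) (lam : ℂ) :
    jostDet b₀ L (lam + T) = 0 ↔ jostDet b₀ L lam = 0 := by
  rw [jostDet, transfer_add_of_mul_eq_pi hL, wronskian_smul_left, jostDet, mul_eq_zero,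
    or_iff_right (pow_ne_zero _ (by norm_num))]

theorem exists_connectedComponentIn_ne {S : Set ℝ} {e : ℝ} (he : e ∉ S) (hS : S ∈ 𝓝[≠] e) :
    ∃ x ∈ S, ∃ y ∈ S, connectedComponentIn S x ≠ connectedComponentIn S y ∧
      e ∈ frontier (connectedComponentIn S x) ∧ e ∈ frontier (connectedComponentIn S y) := by
  rw [← Iio_union_Ioi, nhdsWithin_union, mem_sup, mem_nhdsLT_iff_exists_Ioo_subset,
    mem_nhdsGT_iff_exists_Ioo_subset] at hS
  obtain ⟨⟨a, ha : a < e, haS⟩, b, hb : e < b, hbS⟩ := hS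
  obtain ⟨x, hx⟩ := nonempty_Ioo.2 ha
  obtain ⟨y, hy⟩ := nonempty_Ioo.2 hb
  have hleft := isPreconnected_Ioo.subset_connectedComponentIn hx haS
  have hright := isPreconnected_Ioo.subset_connectedComponentIn hy hbS
  have hnot (z : ℝ) : e ∉ interior (connectedComponentIn S z) := fun h ↦
    he (connectedComponentIn_subset _ _ (interior_subset h))
  refine ⟨x, haS hx, y, hbS hy, fun heq ↦ ?_, ⟨closure_mono hleft ?_, hnot x⟩,
    ⟨closure_mono hright ?_, hnot y⟩⟩
  · have hmem : e ∈ connectedComponentIn S y :=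
      isPreconnected_connectedComponentIn.ordConnected.out (heq ▸ hleft hx) (hright hy)
        ⟨hx.2.le, hy.1.le⟩
    exact he (connectedComponentIn_subset _ _ hmem)
  · exact closure_Ioo ha.ne ▸ right_mem_Icc.2 ha.le
  · exact closure_Ioo hb.ne ▸ left_mem_Icc.2 hb.le

section Balanced

variable {b₁ b₂ x₂ : ℝ}

theorem lyapunov_of_balanced (h : b₂ * x₂ = b₁ * (1 - x₂)) (lam : ℝ) :
    lyapunov b₁ b₂ x₂ lam = 1 - (rho b₁ b₂ + 1) * Real.sin (lam * (x₂ * b₂)) ^ 2 := by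
  have hadd : lam * (x₂ * b₂ + (1 - x₂) * b₁) = 2 * (lam * (x₂ * b₂)) := by
    linear_combination (-lam) * h
  have hsub : lam * (x₂ * b₂ - (1 - x₂) * b₁) = 0 := by
    linear_combination lam * h
  rw [lyapunov, hadd, hsub, Real.cos_two_mul, Real.cos_zero]
  linear_combination (rho b₁ b₂ + 1) * Real.sin_sq_add_cos_sq (lam * (x₂ * b₂))

theorem bandSpectrum_mem_nhdsNE_of_balanced (hb₁ : 0 < b₁) (hb₂ : 0 < b₂) (hx₀ : x₂ ≠ 0)
    (h : b₂ * x₂ = b₁ * (1 - x₂)) {e : ℝ} (he : Real.sin (e * (x₂ * b₂)) = 0) :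
    bandSpectrum b₁ b₂ x₂ ∈ 𝓝[≠] e := by
  have hρ : 0 < rho b₁ b₂ := by
    unfold rho
    positivity
  have hderiv : HasDerivAt (fun lam ↦ Real.sin (lam * (x₂ * b₂)))
      (Real.cos (e * (x₂ * b₂)) * (x₂ * b₂)) e := (hasDerivAt_mul_const _).sin
  have hcos : Real.cos (e * (x₂ * b₂)) ≠ 0 := fun hcos ↦ by
    simpa [he, hcos] using Real.sin_sq_add_cos_sq (e * (x₂ * b₂))
  have hlim : Tendsto (lyapunov b₁ b₂ x₂) (𝓝[≠] e) (𝓝 1) := by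
    have hcont : Continuous (lyapunov b₁ b₂ x₂) := by
      unfold lyapunov
      fun_prop
    simpa [lyapunov_of_balanced h e, he] using (hcont.tendsto e).mono_left nhdsWithin_le_nhds
  filter_upwards [hderiv.eventually_ne (c := 0) (mul_ne_zero hcos (mul_ne_zero hx₀ hb₂.ne')),
    hlim.eventually_const_lt (neg_one_lt_zero.trans one_pos)] with lam hsin hlt
  rw [bandSpectrum, mem_ofPred_eq, sq_abs, sq_lt_one_iff_abs_lt_one, abs_lt]
  refine ⟨hlt, ?_⟩
  rw [lyapunov_of_balanced h]
  exact sub_lt_self 1 (by positivity)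

theorem isDegenerateBandEdge_of_balanced (hb₁ : 0 < b₁) (hb₂ : 0 < b₂) (hx₀ : 0 < x₂)
    (h : b₂ * x₂ = b₁ * (1 - x₂)) (m : ℤ) :
    IsDegenerateBandEdge b₁ b₂ x₂ (Real.pi * m / (x₂ * b₂)) := by
  have hsin : Real.sin (Real.pi * m / (x₂ * b₂) * (x₂ * b₂)) = 0 := by
    rw [div_mul_cancel₀ _ (by positivity), mul_comm, Real.sin_int_mul_pi]
  have hone : lyapunov b₁ b₂ x₂ (Real.pi * m / (x₂ * b₂)) = 1 := by
    rw [lyapunov_of_balanced h, hsin]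
    ring
  obtain ⟨x, hx, y, hy, hne, hfx, hfy⟩ := exists_connectedComponentIn_ne
    (by simp [bandSpectrum, hone]) (bandSpectrum_mem_nhdsNE_of_balanced hb₁ hb₂ hx₀.ne' h hsin)
  exact ⟨.inl hone, _, _, ⟨x, hx, rfl⟩, ⟨y, hy, rfl⟩, hne, hfx, hfy⟩

end Balanced

/-! ### Floquet multipliers -/

section UnimodularMatrix

variable {K : Type*} [Field K] {M : Matrix (Fin 2) (Fin 2) K} {μ : K}

theorem sub_inv_smul_pow_of_det_eq_one (hdet : M.det = 1) (htr : M.trace = μ + μ⁻¹) (hμ : μ ≠ 0)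
    (n : ℕ) : (μ - μ⁻¹) • M ^ n = μ ^ n • (M - μ⁻¹ • 1) - μ⁻¹ ^ n • (M - μ • 1) := by
  have hsq : M * M = (μ + μ⁻¹) • M - 1 := by
    have h := M.aeval_self_charpoly
    rw [Matrix.charpoly_fin_two, hdet, htr] at h
    simp only [map_add, map_sub, map_mul, Polynomial.aeval_X, Polynomial.aeval_C, map_one, sq,
      Algebra.algebraMap_eq_smul_one, ← add_smul] at h
    rwa [smul_one_mul, ← eq_neg_iff_add_eq_zero, sub_eq_iff_eq_add', ← sub_eq_add_neg] at h
  induction n with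
  | zero =>
    simp only [pow_zero, one_smul]
    module
  | succ n ih =>
    rw [pow_succ, ← smul_mul_assoc, ih, sub_mul, smul_mul_assoc, smul_mul_assoc, sub_mul, sub_mul,
      hsq, smul_one_mul, smul_one_mul]
    match_scalars
    · ring
    · linear_combination (μ ^ n - μ⁻¹ ^ n) * mul_inv_cancel₀ hμ

theorem sub_inv_sq_of_pow_apply_eq_zero (hdet : M.det = 1) (htr : M.trace = μ + μ⁻¹) (hμ : μ ≠ 0)
    {n : ℕ} (h : (M ^ n) 1 1 = 0) :
    (μ - μ⁻¹) ^ 2 = -((μ ^ n - μ⁻¹ ^ n) ^ 2 * (M 0 1 * M 1 0)) := by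
  have hoff {i j : Fin 2} (hij : i ≠ j) :
      (μ - μ⁻¹) * (M ^ n) i j = (μ ^ n - μ⁻¹ ^ n) * M i j := by
    have := congrFun₂ (sub_inv_smul_pow_of_det_eq_one hdet htr hμ n) i j
    simp only [Matrix.smul_apply, Matrix.sub_apply, Matrix.one_apply_ne hij, smul_eq_mul] at this
    linear_combination this
  have hdet' : -((M ^ n) 0 1 * (M ^ n) 1 0) = 1 := by
    rw [← zero_sub, ← mul_zero ((M ^ n) 0 0), ← h, ← Matrix.det_fin_two, Matrix.det_pow, hdet,
      one_pow]
  linear_combination (-(μ - μ⁻¹) ^ 2) * hdet' - (μ - μ⁻¹) * (M ^ n) 1 0 * hoff zero_ne_one -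
    (μ ^ n - μ⁻¹ ^ n) * M 0 1 * hoff one_ne_zero

theorem exists_mulVec_eq_smul_of_trace_eq (hdet : M.det = 1) (htr : M.trace = μ + μ⁻¹)
    (hμ : μ ≠ 0) : ∃ v, v ≠ 0 ∧ M.mulVec v = μ • v := by
  have hzero : (M - μ • 1).det = 0 := by
    rw [Matrix.det_fin_two] at hdet ⊢
    rw [Matrix.trace_fin_two] at htr
    simp only [Matrix.sub_apply, Matrix.smul_apply, Matrix.one_apply_eq, smul_eq_mul, mul_one,
      Matrix.one_apply_ne zero_ne_one, Matrix.one_apply_ne one_ne_zero, mul_zero, sub_zero]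
    linear_combination hdet - μ * htr - mul_inv_cancel₀ hμ
  obtain ⟨v, hv, hMv⟩ := Matrix.exists_mulVec_eq_zero_iff.2 hzero
  refine ⟨v, hv, ?_⟩
  rwa [Matrix.sub_mulVec, Matrix.smul_mulVec, Matrix.one_mulVec, sub_eq_zero] at hMv

end UnimodularMatrix

theorem exists_one_le_norm_eq_add_inv (τ : ℂ) : ∃ μ : ℂ, 1 ≤ ‖μ‖ ∧ τ = μ + μ⁻¹ := by
  obtain ⟨s, hs⟩ := IsAlgClosed.exists_pow_nat_eq (τ ^ 2 - 4) two_pos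
  set μ := (τ + s) / 2 with hμ
  have hmul : μ * (τ - μ) = 1 := by
    rw [hμ]
    linear_combination -hs / 4
  have hinv : μ⁻¹ = τ - μ := inv_eq_of_mul_eq_one_right hmul
  rcases le_total 1 ‖μ‖ with h | h
  · exact ⟨μ, h, by rw [hinv, add_sub_cancel]⟩
  · refine ⟨μ⁻¹, ?_, by rw [inv_inv, hinv, sub_add_cancel]⟩
    rw [norm_inv]
    exact (one_le_inv₀ (norm_pos_iff.2 (left_ne_zero_of_mul_eq_one hmul))).2 h

theorem norm_mul_pow_sub_one_le {μ : ℂ} (hμ : 1 ≤ ‖μ‖) (n : ℕ) :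
    ‖μ‖ * (‖μ‖ ^ n - 1) ≤ ‖μ ^ (n + 1) - μ⁻¹ ^ (n + 1)‖ := by
  have hinv : ‖μ⁻¹ ^ (n + 1)‖ ≤ 1 := by
    rw [norm_pow, norm_inv]
    exact pow_le_one₀ (by positivity) (inv_le_one_of_one_le₀ hμ)
  calc ‖μ‖ * (‖μ‖ ^ n - 1) = ‖μ ^ (n + 1)‖ - ‖μ‖ := by
        rw [norm_pow]
        ring
    _ ≤ ‖μ ^ (n + 1)‖ - ‖μ⁻¹ ^ (n + 1)‖ := by linarith
    _ ≤ ‖μ ^ (n + 1) - μ⁻¹ ^ (n + 1)‖ := norm_sub_norm_le _ _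

section HyperbolicMatrix

variable {M : Matrix (Fin 2) (Fin 2) ℂ} {μ s : ℂ} {n : ℕ}

theorem apply_mul_apply_ne_zero_of_pow_apply_eq_zero (hdet : M.det = 1)
    (htr : M.trace = μ + μ⁻¹) (hμ : 1 < ‖μ‖) (h : (M ^ n) 1 1 = 0) : M 0 1 * M 1 0 ≠ 0 := by
  intro hM
  have hsq := sub_inv_sq_of_pow_apply_eq_zero hdet htr (norm_pos_iff.1 (zero_lt_one.trans hμ)) h
  rw [hM, mul_zero, neg_zero, sq_eq_zero_iff, sub_eq_zero] at hsq
  have hnorm := congrArg norm hsq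
  rw [norm_inv] at hnorm
  exact (hμ.trans_eq hnorm).not_gt (inv_lt_one_of_one_lt₀ hμ)

theorem norm_mul_pow_sub_one_le_two_of_pow_apply_eq_zero (hdet : M.det = 1)
    (htr : M.trace = μ + μ⁻¹) (hμ : 1 ≤ ‖μ‖) (hs : M 0 1 * M 1 0 = s ^ 2)
    (h : (M ^ (n + 1)) 1 1 = 0) : ‖s‖ * (‖μ‖ ^ n - 1) ≤ 2 := by
  have hμ₀ : 0 < ‖μ‖ := zero_lt_one.trans_le hμ
  have hsq := sub_inv_sq_of_pow_apply_eq_zero hdet htr (norm_pos_iff.1 hμ₀) h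
  rw [hs, ← mul_pow] at hsq
  have hnorm : ‖μ ^ (n + 1) - μ⁻¹ ^ (n + 1)‖ * ‖s‖ = ‖μ - μ⁻¹‖ := by
    rw [← norm_mul, ← pow_left_inj₀ (norm_nonneg _) (norm_nonneg _) two_ne_zero, ← norm_pow,
      ← norm_pow, hsq, norm_neg]
  have hinv : ‖μ⁻¹‖ ≤ ‖μ‖ := by
    rw [norm_inv]
    exact (inv_le_one_of_one_le₀ hμ).trans hμ
  refine le_of_mul_le_mul_left ?_ hμ₀
  calc ‖μ‖ * (‖s‖ * (‖μ‖ ^ n - 1)) = ‖μ‖ * (‖μ‖ ^ n - 1) * ‖s‖ := by ring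
    _ ≤ ‖μ ^ (n + 1) - μ⁻¹ ^ (n + 1)‖ * ‖s‖ := by
        gcongr
        exact norm_mul_pow_sub_one_le hμ n
    _ = ‖μ - μ⁻¹‖ := hnorm
    _ ≤ ‖μ‖ * 2 := by linarith [norm_sub_le μ μ⁻¹]

end HyperbolicMatrix

theorem abs_im_le_norm_sin (θ : ℂ) : |θ.im| ≤ ‖Complex.sin θ‖ := by
  have key {θ : ℂ} (hθ : 0 ≤ θ.im) : θ.im ≤ ‖Complex.sin θ‖ := by
    refine (Real.self_le_sinh_iff.2 hθ).trans ?_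
    rw [Complex.sin, norm_div, Complex.norm_two, norm_mul, Complex.norm_I, mul_one, Real.sinh_eq]
    gcongr
    refine le_trans (le_of_eq ?_) (norm_sub_norm_le _ _)
    simp [Complex.norm_exp]
  rcases le_total 0 θ.im with h | h
  · rw [abs_of_nonneg h]
    exact key h
  · simpa [abs_of_nonpos h] using key (θ := -θ) (by simpa using h)

/-- The amplitudes of the right- and left-going waves of a state `w` in the medium `b⁻²`, up to the
factor `2b`. -/
def waveCoords (b : ℝ) (w : ℂ × ℂ) : Fin 2 → ℂ :=
  ![w.1 + b * w.2, w.1 - b * w.2]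

/-- The reflection contrast of two layers, the companion of `rho` with `rho² - contrast² = 1`. -/
def contrast (b₁ b₂ : ℝ) : ℝ := (b₁ ^ 2 - b₂ ^ 2) / (2 * b₁ * b₂)

/-- The matrix of `layer b θ` in the coordinates `waveCoords b₀`. -/
def layerMatrix (b₀ b : ℝ) (θ : ℂ) : Matrix (Fin 2) (Fin 2) ℂ :=
  !![Complex.cos θ + I * rho b₀ b * Complex.sin θ, I * contrast b₀ b * Complex.sin θ;
    -(I * contrast b₀ b * Complex.sin θ), Complex.cos θ - I * rho b₀ b * Complex.sin θ]

/-- The matrix of `transfer lam L` in the coordinates `waveCoords b₀`. -/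
def transferMatrix (b₀ : ℝ) (lam : ℂ) : List (ℝ × ℝ) → Matrix (Fin 2) (Fin 2) ℂ
  | [] => 1
  | p :: L => transferMatrix b₀ lam L * layerMatrix b₀ p.1 (lam * p.1 * p.2)

section WaveCoords

variable {b₀ b : ℝ} {lam : ℂ} {L : List (ℝ × ℝ)}

theorem waveCoords_smul (b : ℝ) (c : ℂ) (w : ℂ × ℂ) :
    waveCoords b (c • w) = c • waveCoords b w := by
  ext i
  fin_cases i <;> simp only [waveCoords, Prod.smul_fst, Prod.smul_snd, smul_eq_mul, Fin.mk_zero,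
    Fin.mk_one, Matrix.cons_val_zero, Matrix.cons_val_one, Pi.smul_apply] <;> ring

theorem waveCoords_bijective (hb : b ≠ 0) : Function.Bijective (waveCoords b) := by
  have hb' : (b : ℂ) ≠ 0 := by exact_mod_cast hb
  refine Function.bijective_iff_has_inverse.2
    ⟨fun v ↦ ((v 0 + v 1) / 2, (v 0 - v 1) / (2 * b)), fun w ↦ ?_, fun v ↦ ?_⟩
  · ext <;> simp only [waveCoords, Matrix.cons_val_zero, Matrix.cons_val_one] <;> field_simp <;>
      ring
  · ext i
    fin_cases i <;> simp only [waveCoords, Fin.mk_zero, Fin.mk_one, Matrix.cons_val_zero,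
      Matrix.cons_val_one] <;> field_simp <;> ring

theorem rho_sq_sub_contrast_sq (hb₀ : b₀ ≠ 0) (hb : b ≠ 0) :
    rho b₀ b ^ 2 - contrast b₀ b ^ 2 = 1 := by
  rw [rho, contrast]
  field_simp
  ring

theorem det_layerMatrix (hb₀ : b₀ ≠ 0) (hb : b ≠ 0) (θ : ℂ) : (layerMatrix b₀ b θ).det = 1 := by
  have h : (rho b₀ b : ℂ) ^ 2 - (contrast b₀ b : ℂ) ^ 2 = 1 := by
    exact_mod_cast rho_sq_sub_contrast_sq hb₀ hb
  rw [layerMatrix, Matrix.det_fin_two_of]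
  linear_combination Complex.sin_sq_add_cos_sq θ + Complex.sin θ ^ 2 * h +
    ((contrast b₀ b : ℂ) ^ 2 - (rho b₀ b : ℂ) ^ 2) * Complex.sin θ ^ 2 * Complex.I_sq

theorem waveCoords_layer (hb₀ : b₀ ≠ 0) (hb : b ≠ 0) (θ : ℂ) (w : ℂ × ℂ) :
    waveCoords b₀ (layer b θ w) = (layerMatrix b₀ b θ).mulVec (waveCoords b₀ w) := by
  have hb₀' : (b₀ : ℂ) ≠ 0 := by exact_mod_cast hb₀
  have hb' : (b : ℂ) ≠ 0 := by exact_mod_cast hb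
  rw [layerMatrix, rho, contrast, Matrix.mulVec_fin_two]
  push_cast
  ext i
  fin_cases i <;> simp only [waveCoords, layer, Fin.mk_zero, Fin.mk_one, Matrix.of_apply,
    Matrix.cons_val_zero, Matrix.cons_val_one] <;> field_simp <;> ring

theorem det_transferMatrix (hb₀ : b₀ ≠ 0) (hL : ∀ p ∈ L, p.1 ≠ 0) :
    (transferMatrix b₀ lam L).det = 1 := by
  induction L with
  | nil => exact Matrix.det_one
  | cons p L ih =>
    obtain ⟨hp, hL⟩ := List.forall_mem_cons.1 hL
    rw [transferMatrix, Matrix.det_mul, ih hL, det_layerMatrix hb₀ hp, one_mul]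

theorem waveCoords_transfer (hb₀ : b₀ ≠ 0) (hL : ∀ p ∈ L, p.1 ≠ 0) (w : ℂ × ℂ) :
    waveCoords b₀ (transfer lam L w) = (transferMatrix b₀ lam L).mulVec (waveCoords b₀ w) := by
  induction L generalizing w with
  | nil => exact (Matrix.one_mulVec _).symm
  | cons p L ih =>
    obtain ⟨hp, hL⟩ := List.forall_mem_cons.1 hL
    rw [transfer_cons, ih hL, waveCoords_layer hb₀ hp, Matrix.mulVec_mulVec, transferMatrix]

theorem jostDet_eq_transferMatrix (hb₀ : b₀ ≠ 0) (hL : ∀ p ∈ L, p.1 ≠ 0) :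
    jostDet b₀ L lam = 2 * b₀ * transferMatrix b₀ lam L 1 1 := by
  have h := congrFun (waveCoords_transfer (lam := lam) hb₀ hL (b₀, -1)) 1
  simp only [waveCoords, Matrix.mulVec_fin_two, Matrix.cons_val_zero, Matrix.cons_val_one, mul_neg,
    mul_one, add_neg_cancel, sub_neg_eq_add, mul_zero, zero_add] at h
  rw [jostDet, wronskian]
  linear_combination h

end WaveCoords

/-! ### Absence of resonances in a strip -/

theorem exp_mul_flux_le_flux_layer {b : ℝ} (hb : 0 < b) {θ : ℂ} (hθ : θ.im ≤ 0) (w : ℂ × ℂ) :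
    Real.exp (-2 * θ.im) * flux w ≤ flux (layer b θ w) := by
  have hexp : Real.exp (2 * θ.im) ≤ Real.exp (-2 * θ.im) := Real.exp_le_exp.2 (by linarith)
  refine le_of_mul_le_mul_left (a := 4 * b) ?_ (by positivity)
  rw [mul_left_comm, four_mul_flux_layer hb.ne', four_mul_flux, mul_sub]
  gcongr

theorem flux_lt_flux_layer {b : ℝ} (hb : 0 < b) {θ : ℂ} (hθ : θ.im < 0) {w : ℂ × ℂ}
    (hw : w ≠ 0) : flux w < flux (layer b θ w) := by
  have hexp : 1 < Real.exp (-2 * θ.im) := Real.one_lt_exp_iff.2 (by linarith)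
  have hexp' : Real.exp (2 * θ.im) < 1 := Real.exp_lt_one_iff.2 (by linarith)
  refine lt_of_mul_lt_mul_left (a := 4 * b) ?_ (by positivity)
  rw [four_mul_flux_layer hb.ne', four_mul_flux]
  by_cases h : w.1 + b * w.2 = 0
  · have h' : w.1 - b * w.2 ≠ 0 := fun h' ↦ hw <| (waveCoords_bijective hb.ne').1 <| by
      simp [waveCoords, h, h']
    rw [h, norm_zero, zero_pow two_ne_zero, mul_zero]
    exact sub_lt_sub_left (mul_lt_of_lt_one_left (by positivity) hexp') _
  · have hright := lt_mul_of_one_lt_left (b := ‖w.1 + b * w.2‖ ^ 2) (by positivity) hexp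
    have hleft := mul_le_of_le_one_left (sq_nonneg ‖w.1 - b * w.2‖) hexp'.le
    linarith

theorem flux_smul (c : ℂ) (w : ℂ × ℂ) : flux (c • w) = ‖c‖ ^ 2 * flux w := by
  rw [flux, flux, ← Complex.re_ofReal_mul, Complex.ofReal_pow, ← Complex.mul_conj']
  simp only [Prod.smul_fst, Prod.smul_snd, smul_eq_mul, map_mul]
  ring_nf

/-- The total optical length `∑ b ℓ` of the layers in `L`. -/
def opticalLength (L : List (ℝ × ℝ)) : ℝ := (L.map fun p ↦ p.1 * p.2).sum

theorem opticalLength_pos {L : List (ℝ × ℝ)} (hL : ∀ p ∈ L, 0 < p.1 ∧ 0 < p.2) (hne : L ≠ []) :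
    0 < opticalLength L :=
  List.sum_pos _ (List.forall_mem_map.2 fun p hp ↦ mul_pos (hL p hp).1 (hL p hp).2)
    (mt List.map_eq_nil_iff.1 hne)

section Growth

variable {b₀ : ℝ} {lam μ : ℂ} {L : List (ℝ × ℝ)}

theorem exp_mul_flux_le_flux_transfer (hL : ∀ p ∈ L, 0 < p.1 ∧ 0 < p.2) (hlam : lam.im ≤ 0)
    (w : ℂ × ℂ) :
    Real.exp (-(2 * lam.im * opticalLength L)) * flux w ≤ flux (transfer lam L w) := by
  induction L generalizing w with
  | nil => simp [opticalLength, transfer]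
  | cons p L ih =>
    obtain ⟨⟨hb, hℓ⟩, hL⟩ := List.forall_mem_cons.1 hL
    have hθ : (lam * p.1 * p.2).im ≤ 0 := by
      rw [im_mul_ofReal_mul_ofReal, mul_assoc]
      exact mul_nonpos_of_nonpos_of_nonneg hlam (by positivity)
    calc Real.exp (-(2 * lam.im * opticalLength (p :: L))) * flux w
        = Real.exp (-(2 * lam.im * opticalLength L)) *
            (Real.exp (-2 * (lam * p.1 * p.2).im) * flux w) := by
          rw [← mul_assoc, ← Real.exp_add, im_mul_ofReal_mul_ofReal, opticalLength, opticalLength,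
            List.map_cons, List.sum_cons]
          ring_nf
      _ ≤ Real.exp (-(2 * lam.im * opticalLength L)) * flux (layer p.1 (lam * p.1 * p.2) w) := by
          gcongr
          exact exp_mul_flux_le_flux_layer hb hθ w
      _ ≤ flux (transfer lam L (layer p.1 (lam * p.1 * p.2) w)) := ih hL _

theorem flux_le_flux_transfer (hL : ∀ p ∈ L, 0 < p.1 ∧ 0 < p.2) (hlam : lam.im ≤ 0) (w : ℂ × ℂ) :
    flux w ≤ flux (transfer lam L w) := by
  have h := flux_transfer_le (L := L.reverse) (lam := -lam)
    (fun p hp ↦ hL p (List.mem_reverse.1 hp)) (by simpa using hlam) (transfer lam L w)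
  have hinv := transfer_transfer_neg_reverse (L := L.reverse)
    (fun p hp ↦ (hL p (List.mem_reverse.1 hp)).1.ne') (-lam) w
  rw [neg_neg, List.reverse_reverse] at hinv
  rwa [hinv] at h

theorem flux_lt_flux_transfer (hL : ∀ p ∈ L, 0 < p.1 ∧ 0 < p.2) (hne : L ≠ []) (hlam : lam.im < 0)
    {w : ℂ × ℂ} (hw : w ≠ 0) : flux w < flux (transfer lam L w) := by
  obtain ⟨p, L, rfl⟩ := List.exists_cons_of_ne_nil hne
  obtain ⟨⟨hb, hℓ⟩, hL⟩ := List.forall_mem_cons.1 hL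
  refine (flux_lt_flux_layer hb ?_ hw).trans_le (flux_le_flux_transfer hL hlam.le _)
  rw [im_mul_ofReal_mul_ofReal, mul_assoc]
  exact mul_neg_of_neg_of_pos hlam (by positivity)

theorem exp_le_norm_of_transfer_eq_smul (hL : ∀ p ∈ L, 0 < p.1 ∧ 0 < p.2) (hne : L ≠ [])
    (hlam : lam.im < 0) (hμ : 1 ≤ ‖μ‖) {w : ℂ × ℂ} (hw : w ≠ 0)
    (h : transfer lam L w = μ • w) : Real.exp (-(lam.im * opticalLength L)) ≤ ‖μ‖ := by
  have hgrow : flux w < ‖μ‖ ^ 2 * flux w := by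
    rw [← flux_smul, ← h]
    exact flux_lt_flux_transfer hL hne hlam hw
  have hpos : 0 < flux w := by
    by_contra! hneg
    exact hgrow.not_ge (mul_le_of_one_le_left hneg (one_le_pow₀ hμ))
  refine (pow_le_pow_iff_left₀ (Real.exp_nonneg _) (norm_nonneg μ) two_ne_zero).1 ?_
  refine le_of_mul_le_mul_right ?_ hpos
  rw [← flux_smul, ← h, ← Real.exp_nat_mul, Nat.cast_ofNat, mul_neg, ← mul_assoc]
  exact exp_mul_flux_le_flux_transfer hL hlam.le w

theorem exp_le_norm_of_trace_eq (hb₀ : b₀ ≠ 0) (hL : ∀ p ∈ L, 0 < p.1 ∧ 0 < p.2) (hne : L ≠ [])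
    (hlam : lam.im < 0) (hμ : 1 ≤ ‖μ‖) (htr : (transferMatrix b₀ lam L).trace = μ + μ⁻¹) :
    Real.exp (-(lam.im * opticalLength L)) ≤ ‖μ‖ := by
  have hL₀ : ∀ p ∈ L, p.1 ≠ 0 := fun p hp ↦ (hL p hp).1.ne'
  have hμ₀ : μ ≠ 0 := norm_pos_iff.1 (zero_lt_one.trans_le hμ)
  obtain ⟨v, hv, hMv⟩ := exists_mulVec_eq_smul_of_trace_eq (det_transferMatrix hb₀ hL₀) htr hμ₀
  obtain ⟨w, rfl⟩ := (waveCoords_bijective hb₀).2 v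
  refine exp_le_norm_of_transfer_eq_smul hL hne hlam hμ (w := w) ?_ ?_
  · rintro rfl
    exact hv (by simp [waveCoords])
  · exact (waveCoords_bijective hb₀).1
      (by rw [waveCoords_transfer hb₀ hL₀, hMv, waveCoords_smul])

end Growth

section Cells

variable {b₁ b₂ x₂ : ℝ} {lam μ : ℂ}

theorem transferMatrix_cellLayers (b₁ b₂ x₂ : ℝ) (lam : ℂ) (k : ℕ) :
    transferMatrix b₁ lam (cellLayers b₁ b₂ x₂ k) =
      transferMatrix b₁ lam (cellLayers b₁ b₂ x₂ 1) ^ k := by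
  induction k with
  | zero => rfl
  | succ k ih =>
    rw [pow_succ, ← ih]
    simp only [cellLayers, transferMatrix, one_mul, mul_assoc]

theorem layerMatrix_self {b : ℝ} (hb : b ≠ 0) (θ : ℂ) : layerMatrix b b θ =
    !![Complex.cos θ + I * Complex.sin θ, 0; 0, Complex.cos θ - I * Complex.sin θ] := by
  have hrho : rho b b = 1 := by
    rw [rho]
    field_simp
    norm_num
  simp [layerMatrix, hrho, contrast]

theorem transferMatrix_cell_mul (hb₁ : b₁ ≠ 0) (lam : ℂ) :
    transferMatrix b₁ lam (cellLayers b₁ b₂ x₂ 1) 0 1 *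
      transferMatrix b₁ lam (cellLayers b₁ b₂ x₂ 1) 1 0 =
        (contrast b₁ b₂ * Complex.sin (lam * b₂ * x₂)) ^ 2 := by
  have hcell : transferMatrix b₁ lam (cellLayers b₁ b₂ x₂ 1) =
      layerMatrix b₁ b₁ (lam * b₁ * ↑(1 - x₂)) * layerMatrix b₁ b₂ (lam * b₂ * x₂) := by
    simp only [cellLayers, transferMatrix, one_mul]
  rw [hcell, layerMatrix_self hb₁, layerMatrix, Matrix.mul_fin_two]
  simp only [Matrix.of_apply, Matrix.cons_val_zero, Matrix.cons_val_one, zero_mul, add_zero,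
    zero_add]
  set θ := lam * b₁ * ↑(1 - x₂)
  linear_combination (contrast b₁ b₂ * Complex.sin (lam * b₂ * x₂)) ^ 2 *
    (Complex.sin_sq_add_cos_sq θ +
      ((I ^ 2 - 1) * Complex.sin θ ^ 2 - Complex.cos θ ^ 2) * Complex.I_sq)

theorem mul_le_norm_contrast_mul_sin (hb₂ : 0 < b₂) (hx₀ : 0 < x₂) {ε : ℝ} (hlam : lam.im ≤ -ε) :
    |contrast b₁ b₂| * (ε * b₂ * x₂) ≤ ‖contrast b₁ b₂ * Complex.sin (lam * b₂ * x₂)‖ := by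
  rw [norm_mul, Complex.norm_real, Real.norm_eq_abs]
  gcongr
  refine le_trans ?_ (abs_im_le_norm_sin _)
  rw [im_mul_ofReal_mul_ofReal, abs_mul, abs_mul, abs_of_pos hb₂, abs_of_pos hx₀]
  gcongr
  exact le_abs.2 (Or.inr (le_neg_of_le_neg hlam))

theorem exists_forall_jostDet_cellLayers_ne_zero (hb₁ : 0 < b₁) (hb₂ : 0 < b₂) (hx₀ : 0 < x₂)
    (hx₁ : x₂ < 1) {ε : ℝ} (hε : 0 < ε) : ∃ K : ℕ, ∀ k : ℕ, K ≤ k → ∀ lam : ℂ, lam.im ≤ -ε →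
      jostDet b₁ (cellLayers b₁ b₂ x₂ k) lam ≠ 0 := by
  have hL := forall_mem_cellLayers (P := fun p ↦ 0 < p.1 ∧ 0 < p.2) ⟨hb₂, hx₀⟩
    ⟨hb₁, sub_pos.2 hx₁⟩
  have hL₀ (k : ℕ) : ∀ p ∈ cellLayers b₁ b₂ x₂ k, p.1 ≠ 0 := fun p hp ↦ (hL k p hp).1.ne'
  have hne : cellLayers b₁ b₂ x₂ 1 ≠ [] := List.cons_ne_nil _ _
  set q := Real.exp (ε * opticalLength (cellLayers b₁ b₂ x₂ 1))
  have hq : 1 < q := Real.one_lt_exp_iff.2 (mul_pos hε (opticalLength_pos (hL 1) hne))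
  set κ := |contrast b₁ b₂| * (ε * b₂ * x₂)
  obtain ⟨n, hn⟩ := pow_unbounded_of_one_lt (1 + 2 / κ) hq
  refine ⟨n + 1, fun k hk lam hlam hzero ↦ ?_⟩
  obtain ⟨j, rfl⟩ := Nat.exists_eq_add_of_le' (le_of_add_le_right hk)
  set M := transferMatrix b₁ lam (cellLayers b₁ b₂ x₂ 1) with hM
  obtain ⟨μ, hμ, htr⟩ := exists_one_le_norm_eq_add_inv M.trace
  have hqμ : q ≤ ‖μ‖ := by
    refine (Real.exp_le_exp.2 ?_).trans
      (exp_le_norm_of_trace_eq hb₁.ne' (hL 1) hne (hlam.trans_lt (neg_lt_zero.2 hε)) hμ htr)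
    rw [← neg_mul]
    exact mul_le_mul_of_nonneg_right (le_neg_of_le_neg hlam) (opticalLength_pos (hL 1) hne).le
  have hdet : M.det = 1 := det_transferMatrix hb₁.ne' (hL₀ 1)
  have hpow : (M ^ (j + 1)) 1 1 = 0 := by
    rw [hM, ← transferMatrix_cellLayers]
    rw [jostDet_eq_transferMatrix hb₁.ne' (hL₀ _)] at hzero
    exact (mul_eq_zero.1 hzero).resolve_left (by exact_mod_cast (mul_pos two_pos hb₁).ne')
  have hs : M 0 1 * M 1 0 = (contrast b₁ b₂ * Complex.sin (lam * b₂ * x₂)) ^ 2 :=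
    transferMatrix_cell_mul hb₁.ne' lam
  have hκ₀ : 0 < κ := mul_pos (abs_pos.2 fun hc ↦ apply_mul_apply_ne_zero_of_pow_apply_eq_zero hdet
    htr (hq.trans_le hqμ) hpow (by rw [hs, hc]; simp)) (by positivity)
  have hlarge : 2 / κ < ‖μ‖ ^ j - 1 := lt_sub_iff_add_lt'.2 <| hn.trans_le <|
    (pow_le_pow_left₀ (Real.exp_nonneg _) hqμ n).trans
      (pow_le_pow_right₀ hμ (Nat.le_of_succ_le_succ hk))
  refine (norm_mul_pow_sub_one_le_two_of_pow_apply_eq_zero hdet htr hμ hs hpow).not_gt ?_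
  calc 2 < κ * (‖μ‖ ^ j - 1) := (div_lt_iff₀' hκ₀).1 hlarge
    _ ≤ _ := mul_le_mul_of_nonneg_right (mul_le_norm_contrast_mul_sin hb₂ hx₀ hlam)
      ((div_pos two_pos hκ₀).trans hlarge).le

end Cells

theorem add_mem_Res_truncatedCoeff_iff {b₁ b₂ x₂ : ℝ} (hb₁ : 0 < b₁) (hb₂ : 0 < b₂) (hx₀ : 0 < x₂)
    (hx₁ : x₂ < 1) (h : b₂ * x₂ = b₁ * (1 - x₂)) (k : ℕ) (lam : ℂ) :
    lam + ((Real.pi / (b₂ * x₂) : ℝ) : ℂ) ∈ Res (truncatedCoeff b₁ b₂ x₂ k) ↔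
      lam ∈ Res (truncatedCoeff b₁ b₂ x₂ k) := by
  have h₂ : Real.pi / (b₂ * x₂) * b₂ * x₂ = Real.pi := by field_simp
  have h₁ : Real.pi / (b₂ * x₂) * b₁ * (1 - x₂) = Real.pi := by
    rw [mul_assoc, ← h, ← mul_assoc, h₂]
  have hphase := forall_mem_cellLayers
    (P := fun p ↦ Real.pi / (b₂ * x₂) * p.1 * p.2 = Real.pi) h₂ h₁ k
  rw [mem_Res_truncatedCoeff_iff hb₁ hb₂ hx₀ hx₁, mem_Res_truncatedCoeff_iff hb₁ hb₂ hx₀ hx₁,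
    Complex.add_im, Complex.ofReal_im, add_zero, jostDet_add_eq_zero_iff hphase]

theorem exists_forall_mem_Res_truncatedCoeff_abs_im_lt {b₁ b₂ x₂ ε : ℝ} (hb₁ : 0 < b₁)
    (hb₂ : 0 < b₂) (hx₀ : 0 < x₂) (hx₁ : x₂ < 1) (hε : 0 < ε) :
    ∃ K : ℕ, ∀ k : ℕ, K ≤ k → ∀ lam ∈ Res (truncatedCoeff b₁ b₂ x₂ k), |lam.im| < ε := by
  obtain ⟨K, hK⟩ := exists_forall_jostDet_cellLayers_ne_zero hb₁ hb₂ hx₀ hx₁ hε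
  refine ⟨K, fun k hk lam hlam ↦ ?_⟩
  obtain ⟨him, hdet⟩ := (mem_Res_truncatedCoeff_iff hb₁ hb₂ hx₀ hx₁).1 hlam
  by_contra hlt
  rw [not_lt, abs_of_neg him] at hlt
  exact hK k hk lam (by linarith) hdet

end LayeredResonances

end

theorem theorem1 (b₁ b₂ x₂ : ℝ) (hb₁ : 0 < b₁) (hb₂ : 0 < b₂) (hx₀ : 0 < x₂) (hx₁ : x₂ < 1) :
    -- the resolvents have meromorphic continuations, so that the resonances are well defined
    (∀ k : ℕ, 1 ≤ k → ∀ N : ℕ, ∃ T,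
      LayeredResonances.IsContinuedResolvent
        (LayeredResonances.truncatedCoeff b₁ b₂ x₂ k) N T) ∧
    -- degenerate band edges and periodicity
    (b₂ * x₂ = b₁ * (1 - x₂) →
      (∀ m : ℤ, LayeredResonances.IsDegenerateBandEdge b₁ b₂ x₂ (Real.pi * m / (x₂ * b₂))) ∧
      (∀ k : ℕ, 1 ≤ k → ∀ lam : ℂ,
        lam + ((Real.pi / (b₂ * x₂) : ℝ) : ℂ) ∈
            LayeredResonances.Res (LayeredResonances.truncatedCoeff b₁ b₂ x₂ k) ↔
          lam ∈ LayeredResonances.Res (LayeredResonances.truncatedCoeff b₁ b₂ x₂ k))) ∧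
    -- the resonances approach the real axis
    (∀ ε : ℝ, 0 < ε → ∃ K : ℕ, ∀ k : ℕ, K ≤ k →
      ∀ lam ∈ LayeredResonances.Res (LayeredResonances.truncatedCoeff b₁ b₂ x₂ k),
        |lam.im| < ε) := by
  exact ⟨fun k _ N ↦
      LayeredResonances.exists_isContinuedResolvent_truncatedCoeff hb₁ hb₂ hx₀ hx₁ k N,
    fun h ↦ ⟨LayeredResonances.isDegenerateBandEdge_of_balanced hb₁ hb₂ hx₀ h,
      fun k _ ↦ LayeredResonances.add_mem_Res_truncatedCoeff_iff hb₁ hb₂ hx₀ hx₁ h k⟩,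
    fun _ ↦ LayeredResonances.exists_forall_mem_Res_truncatedCoeff_abs_im_lt hb₁ hb₂ hx₀ hx₁⟩
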